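/- Work in the language of second-order arithmetic and let $\mathsf{RCA}_0$ be the usual system: the basic axioms for $0,1,+,\cdot,<$, induction for $\Sigma^0_1$ formulas and comprehension for $\Delta^0_1$ formulas (number and set parameters allowed). $\mathsf{WKL}$ is the statement that every infinite subtree of $2^{<\omega}$ has a path. For a subtree $C$ of $2^{<\omega}$, $[C]$ denotes the set of paths through $C$; for $X\in 2^\omega$, $X\restriction l$ denotes the initial segment of $X$ of length $l$. A function $f:2^{<\omega}\to 2^{<\omega}$ encodes a continuous transformation of $2^\omega$ if it is total, is order preserving ($\sigma\preceq\tau$ implies $f(\sigma)\preceq f(\tau)$), and satisfies $(\forall l)(\exists m)(\forall\sigma\in\{0,1\}^m)\ |f(\sigma)|\ge l$. A pair $(C,f)$ encodes a topological dynamical system on $2^\omega$ (a system, for short) if $C\subseteq 2^{<\omega}$ is a tree, $f$ encodes a continuous transformation of $2^\omega$, $[C]\neq\emptyset$, and $f(\sigma)\in C$ for all $\sigma\in C$. Put $f^0(\sigma)=\sigma$, $f^{k+1}(\sigma)=f(f^k(\sigma))$ and $F^k(X)=\lim_{l} f^k(X\restriction l)$. A recurrent point of $(C,f)$ is an $X\in[C]$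 such that $$(\forall n,c)(\exists k)\quad F^{n+k}(X)\succeq X\restriction c .$$ $\mathsf{RP}$ is the statement that every system $(C,f)$ has a recurrent point. Theorem. Over $\mathsf{RCA}_0$, $\mathsf{WKL}$ implies $\mathsf{RP}$; that is, every model $(M,S)$ of $\mathsf{RCA}_0$ (with $M$ not necessarily the standard natural numbers) that satisfies $\mathsf{WKL}$ also satisfies $\mathsf{RP}$. -/

import Mathlib

namespace SecondOrderArithmetic

/-! ### Bounded-quantifier formulas of the language of second-order arithmetic -/

/-- Number terms of the language of second-order arithmetic, with number variables indexed by `ℕ`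
(de Bruijn indices). -/
inductive Tm : Type
  | var (i : ℕ) : Tm
  | zero : Tm
  | one : Tm
  | add (s t : Tm) : Tm
  | mul (s t : Tm) : Tm

/-- Formulas of the language of second-order arithmetic all of whose quantifiers are bounded number
quantifiers. Set variables are indexed by `ℕ`, and `mem t k` says that `t` belongs to the `k`-th
set variable. The bounded quantifiers bind the number variable `0` of their body; the bounding
term `t` lies outside the scope of the quantifier. -/
inductive BddFormula : Type
  | eq (s t : Tm) : BddFormula
  | lt (s t : Tm) : BddFormula
  | mem (t : Tm) (k : ℕ) : BddFormula
  | not (φ : BddFormula) : BddFormula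
  | and (φ ψ : BddFormula) : BddFormula
  | or (φ ψ : BddFormula) : BddFormula
  | imp (φ ψ : BddFormula) : BddFormula
  | allLt (t : Tm) (φ : BddFormula) : BddFormula
  | exLt (t : Tm) (φ : BddFormula) : BddFormula

section

variable {M : Type*} [Zero M] [One M] [Add M] [Mul M] [LT M]

/-- The assignment that gives `x` to variable `0` and `v i` to variable `i + 1`. -/
def push (x : M) (v : ℕ → M) : ℕ → M
  | 0 => x
  | i + 1 => v i

/-- The value of a term. -/
def Tm.val (v : ℕ → M) : Tm → M
  | .var i => v i
  | .zero => 0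
  | .one => 1
  | .add s t => s.val v + t.val v
  | .mul s t => s.val v * t.val v

/-- Truth of a bounded-quantifier formula, `A` and `v` being the values of the set variables and
of the number variables. -/
def BddFormula.Holds (A : ℕ → Set M) : BddFormula → (ℕ → M) → Prop
  | .eq s t, v => s.val v = t.val v
  | .lt s t, v => s.val v < t.val v
  | .mem t k, v => t.val v ∈ A k
  | .not φ, v => ¬ φ.Holds A v
  | .and φ ψ, v => φ.Holds A v ∧ ψ.Holds A v
  | .or φ ψ, v => φ.Holds A v ∨ ψ.Holds A v
  | .imp φ ψ, v => φ.Holds A v → ψ.Holds A v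
  | .allLt t φ, v => ∀ x, x < t.val v → φ.Holds A (push x v)
  | .exLt t φ, v => ∃ x, x < t.val v ∧ φ.Holds A (push x v)

/-! ### Models of `RCA₀`

A structure for the language of second-order arithmetic is given by a type `M` of numbers with
`0, 1, +, ·, <` and by a nonempty collection `S` of subsets of `M` over which the set quantifiers
range. -/

/-- The basic axioms of arithmetic. -/
structure BasicAxioms (M : Type*) [Zero M] [One M] [Add M] [Mul M] [LT M] : Prop where
  succ_ne_zero : ∀ n : M, n + 1 ≠ 0
  succ_inj : ∀ m n : M, m + 1 = n + 1 → m = n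
  add_zero : ∀ m : M, m + 0 = m
  add_succ : ∀ m n : M, m + (n + 1) = (m + n) + 1
  mul_zero : ∀ m : M, m * 0 = 0
  mul_succ : ∀ m n : M, m * (n + 1) = m * n + m
  not_lt_zero : ∀ m : M, ¬ m < 0
  lt_succ : ∀ m n : M, m < n + 1 ↔ (m < n ∨ m = n)

/-- Induction for `Σ⁰₁` formulas `∃ y, φ(y, x)` (`φ` has bounded quantifiers only; number and set
parameters are allowed). -/
def Sigma1Induction (S : Set (Set M)) : Prop :=
  ∀ (φ : BddFormula) (A : ℕ → Set M) (v : ℕ → M), (∀ k, A k ∈ S) →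
    (∃ y, φ.Holds A (push y (push 0 v))) →
    (∀ x, (∃ y, φ.Holds A (push y (push x v))) → ∃ y, φ.Holds A (push y (push (x + 1) v))) →
    ∀ x, ∃ y, φ.Holds A (push y (push x v))

/-- Comprehension for `Δ⁰₁` properties: if `∃ y, φ(y, x)` and `∀ y, ψ(y, x)` are equivalent for all
`x` (`φ`, `ψ` have bounded quantifiers only; number and set parameters are allowed), then
`{x | ∃ y, φ(y, x)}` is a set of the structure. -/
def Delta1Comprehension (S : Set (Set M)) : Prop :=
  ∀ (φ ψ : BddFormula) (A : ℕ → Set M) (v : ℕ → M), (∀ k, A k ∈ S) →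
    (∀ x, (∃ y, φ.Holds A (push y (push x v))) ↔ ∀ y, ψ.Holds A (push y (push x v))) →
    {x | ∃ y, φ.Holds A (push y (push x v))} ∈ S

/-- `(M, S)` is a model of `RCA₀`. -/
structure ModelsRCA0 (S : Set (Set M)) : Prop where
  nonempty : S.Nonempty
  basic : BasicAxioms M
  induction : Sigma1Induction S
  comprehension : Delta1Comprehension S

/-! ### Coding of pairs and of finite binary strings by numbers -/

/-- The pairing function `(i + j)² + i`. -/
def pair (i j : M) : M := (i + j) * (i + j) + i

/-- The number `x = (l, (m, n))` describes a binary string of length `l`. -/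
def HasLength (x l : M) : Prop := ∃ m n, x = pair l (pair m n)

/-- The `i`-th digit of the binary string described by `x = (l, (m, n))` is `1`: this means that
`i < l` and `m (i + 1) + 1` divides `n`. (All other digits at places `i < l` are `0`.) -/
def DigitOne (x i : M) : Prop :=
  ∃ l m n, x = pair l (pair m n) ∧ i < l ∧ ∃ q, n = (m * (i + 1) + 1) * q

/-- The numbers `x` and `y` describe the same binary string. -/
def SameString (x y : M) : Prop :=
  (∃ l, HasLength x l ∧ HasLength y l) ∧ ∀ i, DigitOne x i ↔ DigitOne y i

/-- `σ` is (the code of) a finite binary string, `σ ∈ 2^{<ω}`: the code of a string is the least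
number that describes it, so that distinct codes are distinct strings. -/
def IsString (σ : M) : Prop :=
  (∃ l, HasLength σ l) ∧ ∀ y, y < σ → ¬ SameString y σ

/-- `σ` is an initial segment of `τ` (`σ ⪯ τ`), for strings `σ` and `τ`. -/
def IsPrefix (σ τ : M) : Prop :=
  ∃ l l', HasLength σ l ∧ HasLength τ l' ∧ (l < l' ∨ l = l') ∧
    ∀ i, i < l → (DigitOne σ i ↔ DigitOne τ i)

/-- `σ` is the initial segment `X ↾ l` of length `l` of `X`, where a subset `X` of the numbers is
identified with its characteristic function, a point of `2^ω`. -/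
def IsRestriction (σ : M) (X : Set M) (l : M) : Prop :=
  IsString σ ∧ HasLength σ l ∧ ∀ i, i < l → (DigitOne σ i ↔ i ∈ X)

/-- `h` is (the graph of) a function from `{x | D x}` to `{y | R y}`. -/
def IsFunction (D R : M → Prop) (h : Set M) : Prop :=
  (∀ z ∈ h, ∃ x y, D x ∧ R y ∧ z = pair x y) ∧ ∀ x, D x → ∃! y, pair x y ∈ h

/-! ### Trees and weak König's lemma -/

/-- `T` is a subtree of `2^{<ω}`. -/
def IsTree (T : Set M) : Prop :=
  (∀ σ ∈ T, IsString σ) ∧ ∀ σ ∈ T, ∀ τ, IsString τ → IsPrefix τ σ → τ ∈ T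

/-- `X` is a path through `T`, `X ∈ [T]`. -/
def IsPath (T X : Set M) : Prop := ∀ l, ∃ σ ∈ T, IsRestriction σ X l

/-- `WKL` holds in `(M, S)`: every infinite subtree of `2^{<ω}` has a path. -/
def WKL (S : Set (Set M)) : Prop :=
  ∀ T ∈ S, IsTree T → (∀ k, ∃ σ ∈ T, k < σ) → ∃ X ∈ S, IsPath T X

/-! ### Topological dynamical systems on Cantor space and recurrent points -/

/-- `f` encodes a continuous transformation of `2^ω`: it is a total order preserving function
`2^{<ω} → 2^{<ω}` such that for all `l` there is `m` with `|f(σ)| ≥ l` for all `σ ∈ {0,1}^m`. -/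
structure EncodesTransformation (f : Set M) : Prop where
  total : IsFunction IsString IsString f
  order : ∀ σ τ σ' τ', pair σ σ' ∈ f → pair τ τ' ∈ f → IsPrefix σ τ → IsPrefix σ' τ'
  length : ∀ l, ∃ m, ∀ σ σ', HasLength σ m → pair σ σ' ∈ f →
    ∃ l', HasLength σ' l' ∧ (l < l' ∨ l = l')

/-- The pair `(C, f)` encodes a system in `(M, S)`. -/
structure IsSystem (S : Set (Set M)) (C f : Set M) : Prop where
  C_mem : C ∈ S
  f_mem : f ∈ S
  tree : IsTree C
  transformation : EncodesTransformation f
  nonempty : ∃ X ∈ S, IsPath C X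
  invariant : ∀ σ ∈ C, ∀ τ, pair σ τ ∈ f → τ ∈ C

/-- `g` is (the graph of) the function `(σ, k) ↦ f^k(σ)` on `2^{<ω} × ω`, defined by recursion:
`f^0(σ) = σ` and `f^(k+1)(σ) = f(f^k(σ))`. -/
structure IsIteration (f g : Set M) : Prop where
  total : IsFunction (fun z => ∃ σ k, IsString σ ∧ z = pair σ k) IsString g
  zero : ∀ σ, IsString σ → pair (pair σ 0) σ ∈ g
  succ : ∀ σ k τ ρ, pair (pair σ k) τ ∈ g → pair τ ρ ∈ f → pair (pair σ (k + 1)) ρ ∈ g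

/-- `Y = F^k(X)`, that is `Y = lim_l f^k(X ↾ l)`, where `g` is the function `(σ, k) ↦ f^k(σ)`:
every `f^k(X ↾ l)` is an initial segment of `Y`, and their lengths are unbounded. -/
def IsIteratedImage (g X : Set M) (k : M) (Y : Set M) : Prop :=
  (∀ l σ τ, IsRestriction σ X l → pair (pair σ k) τ ∈ g → ∃ m, IsRestriction τ Y m) ∧
    ∀ m, ∃ l σ τ m', IsRestriction σ X l ∧ pair (pair σ k) τ ∈ g ∧ HasLength τ m' ∧ m < m'

/-- `X` is a recurrent point of `(C, f)`: `X ∈ [C]`, and for all `n`, `c` there is `k` such that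
`F^(n+k)(X)` extends `X ↾ c`. -/
def IsRecurrentPoint (S : Set (Set M)) (C f X : Set M) : Prop :=
  X ∈ S ∧ IsPath C X ∧ ∃ g ∈ S, IsIteration f g ∧
    ∀ n c, ∃ k, ∃ Y ∈ S, IsIteratedImage g X (n + k) Y ∧ ∀ i, i < c → (i ∈ Y ↔ i ∈ X)

/-- `RP` holds in `(M, S)`: every topological dynamical system on Cantor space has a recurrent
point. -/
def RP (S : Set (Set M)) : Prop :=
  ∀ C f : Set M, IsSystem S C f → ∃ X, IsRecurrentPoint S C f X

end

end SecondOrderArithmetic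

/-! Rather than passing to a minimal subsystem, the argument fixes bounds on return times in advance
and lets compactness find a point that obeys them. Let `B s` bound the codes of strings of length
`s`, and put `V 0 = 1`, `V (s + 1) = (B (s + 1) + 1) * (V s + (s + 1))`. Keep those `τ ∈ C` for
which, at every scale `s ≤ |τ|`, some `j` with `s ≤ j ≤ V s` is such that the digits of `f^j(τ)`
below `s`, as far as they are determined, agree with `τ`. All quantifiers are bounded, so this
`returnTree` is a set of the model. A path `X` through it is recurrent: on an initial segment so
long that every `f^j` with `j ≤ V s` shows `s` digits, the condition says that some `F^j(X)` with `j
≥ s` agrees with `X` below `s` (`exists_return`).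

The tree has strings of every length by a finite combinatorial fact about orbit segments
(`exists_returns`): among the times below `V L` there is one whose colours at all scales `r ≤ L`
come back after at least `r` and at most `V r` steps. This goes by induction on the scale. An
interval of length `V (s + 1)` has room for `B (s + 1) + 1` spaced blocks of length `V s`; each
contains a time good up to scale `s`, two of these times share a colour at scale `s + 1`, and the
earlier one is good up to `s + 1`. In the orbit of a long string of `C`, with first `s` digits as
the colour at scale `s`, the first `L` digits at a good time form a string of the tree
(`exists_mem_returnTree`).

As `M` may be nonstandard, the finite combinatorics has to be carried out inside the model: `Δ⁰₁`
predicates are closed under bounded quantification (by `Σ⁰₁` collection), finite sets are coded by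
divisibility, and recursion and the pigeonhole principle follow from `Σ⁰₁` and `Π⁰₁` induction. -/

set_option linter.unusedSectionVars false

namespace SecondOrderArithmetic

/-! ### Renaming of variables -/

/-- The renaming of variables under a number quantifier. -/
def liftRename (ρ : ℕ → ℕ) : ℕ → ℕ
  | 0 => 0
  | i + 1 => ρ i + 1

/-- Renaming of number variables in a term. -/
def Tm.rename (ρ : ℕ → ℕ) : Tm → Tm
  | .var i => .var (ρ i)
  | .zero => .zero
  | .one => .one
  | .add s t => .add (s.rename ρ) (t.rename ρ)
  | .mul s t => .mul (s.rename ρ) (t.rename ρ)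

/-- Renaming of number and set variables in a formula. -/
def BddFormula.rename (κ : ℕ → ℕ) : (ℕ → ℕ) → BddFormula → BddFormula
  | ρ, .eq s t => .eq (s.rename ρ) (t.rename ρ)
  | ρ, .lt s t => .lt (s.rename ρ) (t.rename ρ)
  | ρ, .mem t k => .mem (t.rename ρ) (κ k)
  | ρ, .not φ => .not (φ.rename κ ρ)
  | ρ, .and φ ψ => .and (φ.rename κ ρ) (ψ.rename κ ρ)
  | ρ, .or φ ψ => .or (φ.rename κ ρ) (ψ.rename κ ρ)
  | ρ, .imp φ ψ => .imp (φ.rename κ ρ) (ψ.rename κ ρ)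
  | ρ, .allLt t φ => .allLt (t.rename ρ) (φ.rename κ (liftRename ρ))
  | ρ, .exLt t φ => .exLt (t.rename ρ) (φ.rename κ (liftRename ρ))

/-- The sequence `u 0, v 0, u 1, v 1, …`. -/
def interleave {α : Type*} (u v : ℕ → α) : ℕ → α := fun i =>
  if i % 2 = 0 then u (i / 2) else v (i / 2)

theorem interleave_even {α : Type*} (u v : ℕ → α) (i : ℕ) : interleave u v (2 * i) = u i := by
  simp [interleave]

theorem interleave_odd {α : Type*} (u v : ℕ → α) (i : ℕ) : interleave u v (2 * i + 1) = v i := by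
  have h1 : (2 * i + 1) % 2 = 1 := by omega
  have h2 : (2 * i + 1) / 2 = i := by omega
  simp [interleave, h1, h2]

theorem even_odd_ext {α : Type*} {u v : ℕ → α} (h0 : ∀ i, u (2 * i) = v (2 * i))
    (h1 : ∀ i, u (2 * i + 1) = v (2 * i + 1)) : u = v := by
  funext i
  rcases Nat.even_or_odd' i with ⟨k, rfl | rfl⟩
  · exact h0 k
  · exact h1 k

/-! ### Definability with parameters, and the axiom schemes in semantic form -/

section Definability

variable {M : Type*} [Zero M] [One M] [Add M] [Mul M] [LT M]

theorem push_comp_liftRename (x : M) (v : ℕ → M) (ρ : ℕ → ℕ) :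
    push x v ∘ liftRename ρ = push x (v ∘ ρ) := by
  funext i
  cases i <;> rfl

theorem Tm.val_rename (ρ : ℕ → ℕ) (v : ℕ → M) (t : Tm) :
    (t.rename ρ).val v = t.val (v ∘ ρ) := by
  induction t with
  | var i => rfl
  | zero => rfl
  | one => rfl
  | add s t hs ht => simp [Tm.rename, Tm.val, hs, ht]
  | mul s t hs ht => simp [Tm.rename, Tm.val, hs, ht]

theorem BddFormula.holds_rename (κ : ℕ → ℕ) (A : ℕ → Set M) (φ : BddFormula) (ρ : ℕ → ℕ)
    (v : ℕ → M) : (φ.rename κ ρ).Holds A v ↔ φ.Holds (A ∘ κ) (v ∘ ρ) := by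
  induction φ generalizing ρ v with
  | eq s t => simp [BddFormula.rename, BddFormula.Holds, Tm.val_rename]
  | lt s t => simp [BddFormula.rename, BddFormula.Holds, Tm.val_rename]
  | mem t k => simp [BddFormula.rename, BddFormula.Holds, Tm.val_rename]
  | not φ h => simp [BddFormula.rename, BddFormula.Holds, h]
  | and φ ψ h1 h2 => simp [BddFormula.rename, BddFormula.Holds, h1, h2]
  | or φ ψ h1 h2 => simp [BddFormula.rename, BddFormula.Holds, h1, h2]
  | imp φ ψ h1 h2 => simp [BddFormula.rename, BddFormula.Holds, h1, h2]
  | allLt t φ h =>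
    simp [BddFormula.rename, BddFormula.Holds, Tm.val_rename, h, push_comp_liftRename]
  | exLt t φ h =>
    simp [BddFormula.rename, BddFormula.Holds, Tm.val_rename, h, push_comp_liftRename]

/-! ### Predicates definable by bounded formulas with parameters -/

/-- `F` is the value of a term with parameters from `M`. -/
def IsTerm (F : (ℕ → M) → M) : Prop :=
  ∃ (t : Tm) (p : ℕ → M), ∀ v, t.val (interleave v p) = F v

/-- `P` is definable by a bounded formula with parameters from `M` and from `S`. -/
def IsDelta0 (S : Set (Set M)) (P : (ℕ → M) → Prop) : Prop :=
  ∃ (φ : BddFormula) (A : ℕ → Set M) (p : ℕ → M), (∀ k, A k ∈ S) ∧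
    ∀ v, φ.Holds A (interleave v p) ↔ P v

/-- Renaming that makes room for further parameters at odd places. -/
def renameLeft : ℕ → ℕ := interleave (fun i => 2 * i) fun i => 2 * (2 * i) + 1

/-- Renaming that makes room for further parameters at even places. -/
def renameRight : ℕ → ℕ := interleave (fun i => 2 * i) fun i => 2 * (2 * i + 1) + 1

/-- Renaming that adapts the parameters to a new bound variable. -/
def renameBinder : ℕ → ℕ :=
  interleave (fun | 0 => 0 | i + 1 => 2 * i + 1) fun i => 2 * i + 1 + 1

theorem interleave_comp_renameLeft {α : Type*} (v p q : ℕ → α) :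
    interleave v (interleave p q) ∘ renameLeft = interleave v p := by
  apply even_odd_ext <;> intro i <;>
    simp [renameLeft, interleave_even, interleave_odd]

theorem interleave_comp_renameRight {α : Type*} (v p q : ℕ → α) :
    interleave v (interleave p q) ∘ renameRight = interleave v q := by
  apply even_odd_ext <;> intro i <;>
    simp [renameRight, interleave_even, interleave_odd]

theorem push_comp_renameBinder (x : M) (v p : ℕ → M) :
    push x (interleave v p) ∘ renameBinder = interleave (push x v) p := by
  apply even_odd_ext <;> intro i
  · rw [interleave_even, Function.comp_apply, renameBinder, interleave_even]
    cases i with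
    | zero => rfl
    | succ i => exact interleave_even v p i
  · rw [interleave_odd, Function.comp_apply, renameBinder, interleave_odd]
    exact interleave_odd v p i

namespace IsTerm

theorem var (i : ℕ) : IsTerm (fun v : ℕ → M => v i) :=
  ⟨.var (2 * i), fun _ => 0, fun _ => interleave_even _ _ _⟩

theorem const (a : M) : IsTerm (fun _ : ℕ → M => a) :=
  ⟨.var (2 * 0 + 1), fun _ => a, fun _ => interleave_odd _ _ _⟩

theorem zero : IsTerm (fun _ : ℕ → M => 0) := const 0

theorem one : IsTerm (fun _ : ℕ → M => 1) := const 1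

theorem add {F G : (ℕ → M) → M} : IsTerm F → IsTerm G → IsTerm (fun v => F v + G v) := by
  rintro ⟨s, p, hs⟩ ⟨t, q, ht⟩
  refine ⟨.add (s.rename renameLeft) (t.rename renameRight), interleave p q, fun v => ?_⟩
  simp [Tm.val, Tm.val_rename, interleave_comp_renameLeft, interleave_comp_renameRight, hs, ht]

theorem mul {F G : (ℕ → M) → M} : IsTerm F → IsTerm G → IsTerm (fun v => F v * G v) := by
  rintro ⟨s, p, hs⟩ ⟨t, q, ht⟩
  refine ⟨.mul (s.rename renameLeft) (t.rename renameRight), interleave p q, fun v => ?_⟩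
  simp [Tm.val, Tm.val_rename, interleave_comp_renameLeft, interleave_comp_renameRight, hs, ht]

end IsTerm

namespace IsDelta0

variable {S : Set (Set M)} {P Q : (ℕ → M) → Prop} {F G : (ℕ → M) → M}

theorem congr (h : IsDelta0 S P) (e : ∀ v, P v ↔ Q v) : IsDelta0 S Q := by
  obtain ⟨φ, A, p, hA, hφ⟩ := h
  exact ⟨φ, A, p, hA, fun v => (hφ v).trans (e v)⟩

theorem eq (hS : S.Nonempty) : IsTerm F → IsTerm G → IsDelta0 S (fun v => F v = G v) := by
  rintro ⟨s, p, hs⟩ ⟨t, q, ht⟩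
  obtain ⟨A, hA⟩ := hS
  refine ⟨.eq (s.rename renameLeft) (t.rename renameRight), fun _ => A, interleave p q,
    fun _ => hA, fun v => ?_⟩
  simp [BddFormula.Holds, Tm.val_rename, interleave_comp_renameLeft, interleave_comp_renameRight,
    hs, ht]

theorem lt (hS : S.Nonempty) : IsTerm F → IsTerm G → IsDelta0 S (fun v => F v < G v) := by
  rintro ⟨s, p, hs⟩ ⟨t, q, ht⟩
  obtain ⟨A, hA⟩ := hS
  refine ⟨.lt (s.rename renameLeft) (t.rename renameRight), fun _ => A, interleave p q,
    fun _ => hA, fun v => ?_⟩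
  simp [BddFormula.Holds, Tm.val_rename, interleave_comp_renameLeft, interleave_comp_renameRight,
    hs, ht]

theorem mem {A : Set M} (hA : A ∈ S) : IsTerm F → IsDelta0 S (fun v => F v ∈ A) := by
  rintro ⟨s, p, hs⟩
  refine ⟨.mem s 0, fun _ => A, p, fun _ => hA, fun v => ?_⟩
  simp [BddFormula.Holds, hs]

theorem not : IsDelta0 S P → IsDelta0 S (fun v => ¬ P v) := by
  rintro ⟨φ, A, p, hA, h⟩
  exact ⟨.not φ, A, p, hA, fun v => not_congr (h v)⟩

/-- A connective needs both formulas over the same parameters. Interleaving the two lists, of sets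
and of numbers, leaves each formula correct after a renaming. -/
theorem exists_common : IsDelta0 S P → IsDelta0 S Q → ∃ (φ ψ : BddFormula) (A : ℕ → Set M)
    (p : ℕ → M), (∀ k, A k ∈ S) ∧ (∀ v, φ.Holds A (interleave v p) ↔ P v) ∧
      ∀ v, ψ.Holds A (interleave v p) ↔ Q v := by
  rintro ⟨φ, A, p, hA, hφ⟩ ⟨ψ, B, q, hB, hψ⟩
  refine ⟨φ.rename (fun k => 2 * k) renameLeft, ψ.rename (fun k => 2 * k + 1) renameRight,
    interleave A B, interleave p q, fun k => ?_, fun v => ?_, fun v => ?_⟩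
  · rcases Nat.even_or_odd' k with ⟨k, rfl | rfl⟩
    · rw [interleave_even]; exact hA k
    · rw [interleave_odd]; exact hB k
  · have : interleave A B ∘ (fun k => 2 * k) = A := funext fun k => interleave_even _ _ _
    rw [BddFormula.holds_rename, interleave_comp_renameLeft, this, hφ]
  · have : interleave A B ∘ (fun k => 2 * k + 1) = B := funext fun k => interleave_odd _ _ _
    rw [BddFormula.holds_rename, interleave_comp_renameRight, this, hψ]

theorem and (hP : IsDelta0 S P) (hQ : IsDelta0 S Q) : IsDelta0 S (fun v => P v ∧ Q v) := by
  obtain ⟨φ, ψ, A, p, hA, h1, h2⟩ := exists_common hP hQ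
  exact ⟨.and φ ψ, A, p, hA, fun v => and_congr (h1 v) (h2 v)⟩

theorem or (hP : IsDelta0 S P) (hQ : IsDelta0 S Q) : IsDelta0 S (fun v => P v ∨ Q v) := by
  obtain ⟨φ, ψ, A, p, hA, h1, h2⟩ := exists_common hP hQ
  exact ⟨.or φ ψ, A, p, hA, fun v => or_congr (h1 v) (h2 v)⟩

theorem imp (hP : IsDelta0 S P) (hQ : IsDelta0 S Q) : IsDelta0 S (fun v => P v → Q v) := by
  obtain ⟨φ, ψ, A, p, hA, h1, h2⟩ := exists_common hP hQ
  exact ⟨.imp φ ψ, A, p, hA, fun v => imp_congr (h1 v) (h2 v)⟩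

theorem ball {R : M → (ℕ → M) → Prop} (hF : IsTerm F)
    (hR : IsDelta0 S (fun w => R (w 0) (fun i => w (i + 1)))) :
    IsDelta0 S (fun v => ∀ x, x < F v → R x v) := by
  obtain ⟨t, q, ht⟩ := hF
  obtain ⟨φ, A, p, hA, h⟩ := hR
  -- Under the quantifier the assignment is `push x` of an interleaving. `renameBinder` turns it
  -- into the interleaving of `push x v` with the parameters, in which form the body is evaluated.
  refine ⟨.allLt (t.rename renameLeft)
    (φ.rename id (liftRename renameRight ∘ renameBinder)), A,
    interleave q p, hA, fun v => ?_⟩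
  simp only [BddFormula.Holds, Tm.val_rename, BddFormula.holds_rename, interleave_comp_renameLeft,
    ht, ← Function.comp_assoc, push_comp_liftRename, interleave_comp_renameRight,
    push_comp_renameBinder, Function.comp_id]
  exact forall_congr' fun x => imp_congr_right fun _ => h (push x v)

theorem bex {R : M → (ℕ → M) → Prop} (hF : IsTerm F)
    (hR : IsDelta0 S (fun w => R (w 0) (fun i => w (i + 1)))) :
    IsDelta0 S (fun v => ∃ x, x < F v ∧ R x v) := by
  refine (ball (R := fun x v => ¬ R x v) hF hR.not).not.congr fun v => ?_
  push Not
  rfl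

/-- Substitution of variables and constants for variables. -/
theorem subst (σ : ℕ → ℕ ⊕ M) : IsDelta0 S P →
    IsDelta0 S (fun v => P (fun i => Sum.elim v id (σ i))) := by
  rintro ⟨φ, A, p, hA, h⟩
  refine ⟨φ.rename id (interleave (fun i => Sum.elim (fun j => 2 * j)
    (fun _ => 2 * (2 * i) + 1) (σ i)) fun i => 2 * (2 * i + 1) + 1), A,
    interleave (fun i => Sum.elim (fun _ => 0) id (σ i)) p, hA, fun v => ?_⟩
  refine (BddFormula.holds_rename _ _ _ _ _).trans (Iff.trans ?_ (h _))
  have : ∀ u w : ℕ → M, u = w → (φ.Holds (A ∘ id) u ↔ φ.Holds A w) := by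
    rintro u _ rfl
    rfl
  apply this
  apply even_odd_ext <;> intro i
  · rcases e : σ i with j | a <;> simp [interleave_even, interleave_odd, e]
  · simp [interleave_odd]

theorem reindex (ρ : ℕ → ℕ) (h : IsDelta0 S P) : IsDelta0 S (fun v => P (fun i => v (ρ i))) :=
  h.subst fun i => .inl (ρ i)

end IsDelta0

/-- `P` is definable by a `Σ⁰₁` formula with parameters from `M` and from `S`. -/
def IsSigma1 (S : Set (Set M)) (P : (ℕ → M) → Prop) : Prop :=
  ∃ Q, IsDelta0 S Q ∧ ∀ v, P v ↔ ∃ y, Q (push y v)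

namespace IsSigma1

variable {S : Set (Set M)} {P Q : (ℕ → M) → Prop}

theorem congr (h : IsSigma1 S P) (e : ∀ v, P v ↔ Q v) : IsSigma1 S Q := by
  obtain ⟨R, hR, h⟩ := h
  exact ⟨R, hR, fun v => (e v).symm.trans (h v)⟩

theorem of_ex {R : M → (ℕ → M) → Prop} (hR : IsDelta0 S (fun w => R (w 0) (fun i => w (i + 1)))) :
    IsSigma1 S (fun v => ∃ x, R x v) :=
  ⟨_, hR, fun _ => Iff.rfl⟩

end IsSigma1

theorem IsDelta0.isSigma1 {S : Set (Set M)} {P : (ℕ → M) → Prop} (h : IsDelta0 S P) :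
    IsSigma1 S P :=
  ⟨_, h.reindex (fun i => i + 1), fun _ => ⟨fun h => ⟨0, h⟩, fun ⟨_, h⟩ => h⟩⟩

/-- The axiom schemes evaluate formulas at `push y (push x p)`. So the parameters are read from
place 2 onwards, and the irrelevant free variables from place 2 on share the same values. -/
theorem exists_formula {S : Set (Set M)} {Q Q' : (ℕ → M) → Prop} (h : IsDelta0 S Q)
    (h' : IsDelta0 S Q') :
    ∃ (φ φ' : BddFormula) (A : ℕ → Set M) (p : ℕ → M), (∀ k, A k ∈ S) ∧
      (∀ x y, φ.Holds A (push y (push x p)) ↔ Q (push y (push x p))) ∧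
      ∀ x y, φ'.Holds A (push y (push x p)) ↔ Q' (push y (push x p)) := by
  obtain ⟨φ, φ', A, p, hA, hφ, hφ'⟩ := h.exists_common h'
  let ρ : ℕ → ℕ := interleave id fun i => i + 2
  have key : ∀ x y, push y (push x p) ∘ ρ = interleave (push y (push x p)) p := by
    intro x y
    apply even_odd_ext <;> intro i
    · simp [ρ, interleave_even]
    · simp [ρ, interleave_odd, push]
  exact ⟨φ.rename id ρ, φ'.rename id ρ, A, p, hA,
    fun x y => by rw [BddFormula.holds_rename, key]; exact hφ _,
    fun x y => by rw [BddFormula.holds_rename, key]; exact hφ' _⟩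

theorem Sigma1Induction.induct {S : Set (Set M)} (h : Sigma1Induction S) {P : M → Prop}
    (hP : IsSigma1 S (fun v => P (v 0))) (zero : P 0) (succ : ∀ x, P x → P (x + 1)) :
    ∀ x, P x := by
  obtain ⟨Q, hQ, e⟩ := hP
  obtain ⟨φ, _, A, p, hA, hφ, -⟩ := exists_formula hQ hQ
  have key : ∀ x, P x ↔ ∃ y, φ.Holds A (push y (push x p)) := fun x => by
    simp only [hφ]
    exact e (push x p)
  simp only [key] at *
  exact h φ A p hA zero succ

theorem Delta1Comprehension.setOf_mem {S : Set (Set M)} (h : Delta1Comprehension S) {P : M → Prop}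
    (hP : IsSigma1 S (fun v => P (v 0))) (hN : IsSigma1 S (fun v => ¬ P (v 0))) :
    {x | P x} ∈ S := by
  obtain ⟨Q, hQ, e⟩ := hP
  obtain ⟨Q', hQ', e'⟩ := hN
  obtain ⟨φ, φ', A, p, hA, hφ, hφ'⟩ := exists_formula hQ hQ'
  have key : ∀ x, P x ↔ ∃ y, φ.Holds A (push y (push x p)) := fun x => by
    simp only [hφ]
    exact e (push x p)
  have key' : ∀ x, P x ↔ ∀ y, (BddFormula.not φ').Holds A (push y (push x p)) := fun x => by
    simp only [BddFormula.Holds, hφ']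
    rw [← not_exists]
    exact (not_iff_comm.1 (e' (push x p))).symm
  have := h φ φ'.not A p hA (fun x => (key x).symm.trans (key' x))
  simpa only [← key] using this

end Definability

/-! ### The numbers of a model of `RCA₀` form an ordered semiring -/

section Bootstrap

variable {M : Type*} [Zero M] [One M] [Add M] [Mul M] [LT M] {S : Set (Set M)}

namespace ModelsRCA0

theorem delta0_induct (h : ModelsRCA0 S) {P : M → Prop} (hP : IsDelta0 S (fun v => P (v 0)))
    (zero : P 0) (succ : ∀ x, P x → P (x + 1)) : ∀ x, P x :=
  h.induction.induct hP.isSigma1 zero succ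

theorem eq_induct (h : ModelsRCA0 S) {F G : M → M} (hF : IsTerm fun v => F (v 0))
    (hG : IsTerm fun v => G (v 0)) (zero : F 0 = G 0)
    (succ : ∀ x, F x = G x → F (x + 1) = G (x + 1)) : ∀ x, F x = G x :=
  h.delta0_induct (.eq h.nonempty hF hG) zero succ

theorem add_zero' (h : ModelsRCA0 S) (m : M) : m + 0 = m := h.basic.add_zero m

theorem add_succ' (h : ModelsRCA0 S) (m n : M) : m + (n + 1) = (m + n) + 1 := h.basic.add_succ m n

theorem zero_add' (h : ModelsRCA0 S) : ∀ m : M, 0 + m = m :=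
  h.eq_induct (.add .zero (.var _)) (.var _) (h.add_zero' 0) fun x e => by rw [h.add_succ', e]

theorem succ_add' (h : ModelsRCA0 S) (m : M) : ∀ n : M, (m + 1) + n = (m + n) + 1 :=
  h.eq_induct (.add (.const _) (.var _)) (.add (.add (.const _) (.var _)) .one)
    (by rw [h.add_zero', h.add_zero']) fun x e => by rw [h.add_succ', h.add_succ', e]

theorem add_comm' (h : ModelsRCA0 S) (m : M) : ∀ n : M, m + n = n + m :=
  h.eq_induct (.add (.const _) (.var _)) (.add (.var _) (.const _))
    (by rw [h.add_zero', h.zero_add']) fun x e => by rw [h.add_succ', h.succ_add', e]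

theorem add_assoc' (h : ModelsRCA0 S) (m n : M) : ∀ k : M, m + n + k = m + (n + k) :=
  h.eq_induct (.add (.const _) (.var _)) (.add (.const _) (.add (.const _) (.var _)))
    (by rw [h.add_zero', h.add_zero']) fun x e => by
      rw [h.add_succ', h.add_succ', h.add_succ', e]

theorem mul_zero' (h : ModelsRCA0 S) (m : M) : m * 0 = 0 := h.basic.mul_zero m

theorem mul_succ' (h : ModelsRCA0 S) (m n : M) : m * (n + 1) = m * n + m := h.basic.mul_succ m n

theorem zero_mul' (h : ModelsRCA0 S) : ∀ m : M, 0 * m = 0 :=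
  h.eq_induct (.mul .zero (.var _)) .zero (h.mul_zero' 0) fun x e => by
    rw [h.mul_succ', e, h.add_zero']

theorem succ_mul' (h : ModelsRCA0 S) (m : M) : ∀ n : M, (m + 1) * n = m * n + n :=
  h.eq_induct (.mul (.const _) (.var _)) (.add (.mul (.const _) (.var _)) (.var _))
    (by rw [h.mul_zero', h.mul_zero', h.add_zero']) fun x e => by
      rw [h.mul_succ', h.mul_succ', e, h.add_succ', h.add_succ', h.add_assoc' (m * x) x m,
        h.add_comm' x m, h.add_assoc' (m * x) m x]

theorem mul_comm' (h : ModelsRCA0 S) (m : M) : ∀ n : M, m * n = n * m :=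
  h.eq_induct (.mul (.const _) (.var _)) (.mul (.var _) (.const _))
    (by rw [h.mul_zero', h.zero_mul']) fun x e => by rw [h.mul_succ', h.succ_mul', e]

theorem mul_add' (h : ModelsRCA0 S) (m n : M) : ∀ k : M, m * (n + k) = m * n + m * k :=
  h.eq_induct (.mul (.const _) (.add (.const _) (.var _)))
    (.add (.const _) (.mul (.const _) (.var _)))
    (by rw [h.mul_zero', h.add_zero', h.add_zero']) fun x e => by
      rw [h.add_succ', h.mul_succ', h.mul_succ', e, h.add_assoc']

theorem mul_assoc' (h : ModelsRCA0 S) (m n : M) : ∀ k : M, m * n * k = m * (n * k) :=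
  h.eq_induct (.mul (.const _) (.var _)) (.mul (.const _) (.mul (.const _) (.var _)))
    (by rw [h.mul_zero', h.mul_zero', h.mul_zero']) fun x e => by
      rw [h.mul_succ', h.mul_succ', h.mul_add', e]

theorem mul_one' (h : ModelsRCA0 S) (m : M) : m * 1 = m := by
  rw [← h.zero_add' 1, h.mul_succ', h.mul_zero', h.zero_add']

theorem add_right_cancel' (h : ModelsRCA0 S) (a b : M) : ∀ c : M, a + c = b + c → a = b :=
  h.delta0_induct (.imp (.eq h.nonempty (.add (.const _) (.var _)) (.add (.const _) (.var _)))
    (.eq h.nonempty (.const _) (.const _)))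
    (fun e => by rwa [h.add_zero', h.add_zero'] at e) fun x ih e => by
      rw [h.add_succ', h.add_succ'] at e
      exact ih (h.basic.succ_inj _ _ e)

theorem lt_add_succ (h : ModelsRCA0 S) (x : M) : ∀ z : M, x < x + z + 1 :=
  h.delta0_induct (.lt h.nonempty (.const _) (.add (.add (.const _) (.var _)) .one))
    ((h.basic.lt_succ _ _).2 (.inr (h.add_zero' x).symm)) fun z ih =>
      (h.basic.lt_succ _ _).2 (.inl (by rwa [h.add_succ']))

theorem lt_iff_exists (h : ModelsRCA0 S) (x y : M) : x < y ↔ ∃ z, y = x + z + 1 := by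
  constructor
  -- The hypothesis `x < y` stands inside the existential quantifier, which makes the statement
  -- `Σ⁰₁`; the witness `0` serves while it fails.
  · have : ∀ y : M, ∃ z, x < y → y = x + z + 1 := by
      refine h.induction.induct (.of_ex (.imp (.lt h.nonempty (.const _) (.var _))
        (.eq h.nonempty (.var _) (.add (.add (.const _) (.var _)) .one)))) ?_ ?_
      · exact ⟨0, fun e => (h.basic.not_lt_zero _ e).elim⟩
      · rintro y ⟨z, hz⟩
        by_cases hy : x < y
        · exact ⟨z + 1, fun _ => by rw [hz hy, h.add_succ']⟩
        · refine ⟨0, fun e => ?_⟩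
          rcases (h.basic.lt_succ _ _).1 e with e | rfl
          · exact (hy e).elim
          · rw [h.add_zero']
    intro hxy
    obtain ⟨z, hz⟩ := this y
    exact ⟨z, hz hxy⟩
  · rintro ⟨z, rfl⟩
    exact h.lt_add_succ x z

theorem lt_irrefl' (h : ModelsRCA0 S) (x : M) : ¬ x < x := by
  rw [h.lt_iff_exists]
  rintro ⟨z, hz⟩
  rw [h.add_assoc', h.add_comm'] at hz
  exact h.basic.succ_ne_zero z (h.add_right_cancel' _ _ x (hz.symm.trans (h.zero_add' x).symm))

theorem lt_trans' (h : ModelsRCA0 S) {x y z : M} (hxy : x < y) (hyz : y < z) : x < z := by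
  rw [h.lt_iff_exists] at *
  obtain ⟨a, rfl⟩ := hxy
  obtain ⟨b, rfl⟩ := hyz
  exact ⟨a + 1 + b, by rw [← h.add_assoc', ← h.add_assoc']⟩

theorem zero_lt_or_eq (h : ModelsRCA0 S) : ∀ y : M, 0 < y ∨ 0 = y :=
  h.delta0_induct (.or (.lt h.nonempty .zero (.var _)) (.eq h.nonempty .zero (.var _)))
    (.inr rfl) fun _ ih => .inl ((h.basic.lt_succ _ _).2 ih)

theorem lt_trichotomy' (h : ModelsRCA0 S) (x : M) : ∀ y : M, x < y ∨ x = y ∨ y < x :=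
  h.delta0_induct (.or (.lt h.nonempty (.const _) (.var _)) (.or
    (.eq h.nonempty (.const _) (.var _)) (.lt h.nonempty (.var _) (.const _))))
    ((h.zero_lt_or_eq x).elim (fun e => .inr (.inr e)) fun e => .inr (.inl e.symm)) fun y ih => by
      rcases ih with e | e | e
      · exact .inl ((h.basic.lt_succ _ _).2 (.inl e))
      · exact .inl ((h.basic.lt_succ _ _).2 (.inr e))
      · obtain ⟨z, rfl⟩ := (h.lt_iff_exists _ _).1 e
        rcases h.zero_lt_or_eq z with hz | rfl
        · obtain ⟨w, rfl⟩ := (h.lt_iff_exists _ _).1 hz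
          refine .inr (.inr ((h.lt_iff_exists _ _).2 ⟨w, ?_⟩))
          rw [h.zero_add', h.add_succ', h.succ_add' y w]
        · exact .inr (.inl (by rw [h.add_zero']))

/-- The semiring structure on the numbers of a model of `RCA₀`. -/
abbrev commSemiring (h : ModelsRCA0 S) : CommSemiring M where
  add_assoc := h.add_assoc'
  zero_add := h.zero_add'
  add_zero := h.add_zero'
  add_comm := h.add_comm'
  left_distrib := h.mul_add'
  right_distrib a b c := by rw [h.mul_comm', h.mul_add', h.mul_comm' c a, h.mul_comm' c b]
  zero_mul := h.zero_mul'
  mul_zero := h.mul_zero'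
  mul_assoc := h.mul_assoc'
  one_mul a := by rw [h.mul_comm', h.mul_one']
  mul_one := h.mul_one'
  mul_comm := h.mul_comm'
  nsmul := nsmulRec

open Classical in
/-- The order on the numbers of a model of `RCA₀`. -/
noncomputable abbrev linearOrder (h : ModelsRCA0 S) : LinearOrder M where
  le x y := x < y ∨ x = y
  lt x y := x < y
  le_refl x := .inr rfl
  le_trans x y z := by
    rintro (hxy | rfl) (hyz | rfl)
    · exact .inl (h.lt_trans' hxy hyz)
    · exact .inl hxy
    · exact .inl hyz
    · exact .inr rfl
  le_antisymm x y := by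
    rintro (hxy | rfl) (hyx | e)
    · exact (h.lt_irrefl' _ (h.lt_trans' hxy hyx)).elim
    · exact e.symm
    · rfl
    · rfl
  lt_iff_le_not_ge x y := by
    constructor
    · intro hxy
      refine ⟨.inl hxy, ?_⟩
      rintro (hyx | rfl)
      · exact h.lt_irrefl' _ (h.lt_trans' hxy hyx)
      · exact h.lt_irrefl' _ hxy
    · rintro ⟨hxy | rfl, hn⟩
      · exact hxy
      · exact (hn (.inr rfl)).elim
  le_total x y := by
    rcases h.lt_trichotomy' x y with e | e | e
    · exact .inl (.inl e)
    · exact .inl (.inr e)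
    · exact .inr (.inl e)
  toDecidableLE := Classical.decRel _

theorem isStrictOrderedRing (h : ModelsRCA0 S) :
    letI := h.commSemiring
    letI := h.linearOrder
    IsStrictOrderedRing M := by
  let := h.commSemiring
  let := h.linearOrder
  have lt_iff : ∀ x y : M, x < y ↔ ∃ z, y = x + z + 1 := h.lt_iff_exists
  have add_lt : ∀ a b c : M, a < b → c + a < c + b := by
    intro a b c hab
    rw [lt_iff] at *
    obtain ⟨z, rfl⟩ := hab
    exact ⟨z, by ring⟩
  have mul_lt : ∀ a b c : M, 0 < c → a < b → c * a < c * b := by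
    intro a b c hc hab
    rw [lt_iff] at *
    obtain ⟨z, rfl⟩ := hab
    obtain ⟨w, rfl⟩ := hc
    exact ⟨w * z + z + w, by ring⟩
  have zero_lt_one : (0 : M) < 1 := (lt_iff _ _).2 ⟨0, by ring⟩
  exact
    { add_le_add_left := fun a b hab c => by
        rcases hab.lt_or_eq with hab | rfl
        · rw [add_comm a, add_comm b]
          exact (add_lt a b c hab).le
        · exact le_rfl
      le_of_add_le_add_left := fun a b c hbc => by
        by_contra hn
        exact (add_lt _ _ a (not_le.1 hn)).not_ge hbc
      zero_le_one := zero_lt_one.le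
      exists_pair_ne := ⟨0, 1, zero_lt_one.ne⟩
      mul_lt_mul_of_pos_left := fun c hc a b hab => mul_lt a b c hc hab
      mul_lt_mul_of_pos_right := fun c hc a b hab => by
        change a * c < b * c
        rw [mul_comm a, mul_comm b]
        exact mul_lt a b c hc hab }

theorem canonicallyOrderedAdd (h : ModelsRCA0 S) :
    letI := h.commSemiring
    letI := h.linearOrder
    CanonicallyOrderedAdd M := by
  let := h.commSemiring
  let := h.linearOrder
  have := h.isStrictOrderedRing
  have zero_le : ∀ x : M, 0 ≤ x := h.zero_lt_or_eq
  exact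
    { exists_add_of_le := fun {a b} hab => by
        rcases hab.lt_or_eq with hab | rfl
        · obtain ⟨z, hz⟩ := (h.lt_iff_exists a b).1 hab
          exact ⟨z + 1, hz.trans (add_assoc a z 1)⟩
        · exact ⟨0, (add_zero a).symm⟩
      le_self_add := fun a b => le_add_of_nonneg_right (zero_le b)
      le_add_self := fun a b => le_add_of_nonneg_left (zero_le b) }

end ModelsRCA0

end Bootstrap

/-! ### Calculus of `Σ⁰₁` and `Δ⁰₁` predicates, induction and least elements -/

section OrderedSemiring

variable {M : Type*} [CommSemiring M] [LinearOrder M] [IsStrictOrderedRing M]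
  [CanonicallyOrderedAdd M] {S : Set (Set M)} [hS : Fact (ModelsRCA0 S)]

/-! ### Closure properties of `Σ⁰₁` predicates -/

omit [IsStrictOrderedRing M] [CanonicallyOrderedAdd M] in
include hS in
variable (S) in
theorem lt_add_one_iff' (x y : M) : x < y + 1 ↔ x ≤ y :=
  (hS.out.basic.lt_succ x y).trans le_iff_lt_or_eq.symm

namespace IsSigma1

variable {P Q : (ℕ → M) → Prop}

/-- One strict common bound on both witnesses replaces two unbounded quantifiers, and the search
below it is bounded. -/
theorem ex {R : M → (ℕ → M) → Prop}
    (h : IsSigma1 S (fun w => R (w 0) (fun i => w (i + 1)))) :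
    IsSigma1 S (fun v => ∃ x, R x v) := by
  obtain ⟨Q, hQ, e⟩ := h
  have e : ∀ v x, R x v ↔ ∃ y, Q (push y (push x v)) := fun v x => e (push x v)
  refine IsSigma1.congr (.of_ex (R := fun b v => ∃ x, x < b ∧ ∃ y, y < b ∧ Q (push y (push x v)))
    (.bex (.var _) (.bex (.var _)
      ((hQ.reindex fun | 0 => 0 | 1 => 1 | i + 2 => i + 3).congr fun v => ?_)))) fun v => ?_
  · exact iff_of_eq (congrArg Q (funext fun | 0 => rfl | 1 => rfl | i + 2 => rfl))
  · simp only [e]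
    constructor
    · rintro ⟨b, x, -, y, -, h⟩
      exact ⟨x, y, h⟩
    · rintro ⟨x, y, h⟩
      refine ⟨max x y + 1, x, ?_, y, ?_, h⟩ <;> simp [lt_add_one_iff' S]

theorem and (hP : IsSigma1 S P) (hQ : IsSigma1 S Q) : IsSigma1 S (fun v => P v ∧ Q v) := by
  obtain ⟨P', hP, e⟩ := hP
  obtain ⟨Q', hQ, e'⟩ := hQ
  refine IsSigma1.congr (P := fun v => ∃ y, ∃ z, P' (push y v) ∧ Q' (push z v)) (.ex (.ex
    (.and ?_ ?_ : IsDelta0 S _).isSigma1)) fun v => ?_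
  · exact (hP.reindex fun | 0 => 1 | i + 1 => i + 2).congr fun v =>
      iff_of_eq (congrArg P' (funext fun | 0 => rfl | i + 1 => rfl))
  · exact (hQ.reindex fun | 0 => 0 | i + 1 => i + 2).congr fun v =>
      iff_of_eq (congrArg Q' (funext fun | 0 => rfl | i + 1 => rfl))
  · simp only [e, e', exists_and_left, exists_and_right]

theorem or (hP : IsSigma1 S P) (hQ : IsSigma1 S Q) : IsSigma1 S (fun v => P v ∨ Q v) := by
  obtain ⟨P', hP, e⟩ := hP
  obtain ⟨Q', hQ, e'⟩ := hQ
  exact ⟨_, hP.or hQ, fun v => by simp only [e, e', exists_or]⟩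

theorem reindex (ρ : ℕ → ℕ) (hP : IsSigma1 S P) : IsSigma1 S (fun v => P (fun i => v (ρ i))) := by
  obtain ⟨P', hP, e⟩ := hP
  refine ⟨_, hP.reindex (liftRename ρ), fun v => (e _).trans (exists_congr fun y => ?_)⟩
  exact iff_of_eq (congrArg P' (funext fun | 0 => rfl | i + 1 => rfl))

/-- This is `Σ⁰₁` collection: the witnesses for all `x < v j` have a common bound, found by
induction on the part of the range already treated. -/
theorem ball_var {R : M → (ℕ → M) → Prop}
    (h : IsSigma1 S (fun w => R (w 0) (fun i => w (i + 1)))) (j : ℕ) :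
    IsSigma1 S (fun v => ∀ x, x < v j → R x v) := by
  obtain ⟨Q, hQ, e⟩ := h
  have e : ∀ v x, R x v ↔ ∃ y, Q (push y (push x v)) := fun v x => e (push x v)
  refine IsSigma1.congr (.of_ex (R := fun b v => ∀ x, x < v j → ∃ y, y < b ∧
    Q (push y (push x v))) (.ball (.var _) (.bex (.var _)
      ((hQ.reindex fun | 0 => 0 | 1 => 1 | i + 2 => i + 3).congr fun v => ?_)))) fun v => ?_
  · exact iff_of_eq (congrArg Q (funext fun | 0 => rfl | 1 => rfl | i + 2 => rfl))
  · simp only [e]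
    constructor
    · rintro ⟨b, h⟩ x hx
      obtain ⟨y, -, hy⟩ := h x hx
      exact ⟨y, hy⟩
    · intro h
      suffices ∀ a, a ≤ v j → ∃ b, ∀ x, x < a → ∃ y, y < b ∧ Q (push y (push x v)) from
        this _ le_rfl
      intro a ha
      -- With `x < v j` inside, the statement holds for all `a`, so plain induction applies with no
      -- restriction on `a`.
      suffices ∃ b, ∀ x, x < a → x < v j → ∃ y, y < b ∧ Q (push y (push x v)) from
        this.imp fun b hb x hx => hb x hx (hx.trans_le ha)
      refine hS.out.induction.induct (P := fun a => ∃ b, ∀ x, x < a → x < v j →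
        ∃ y, y < b ∧ Q (push y (push x v))) (.of_ex (.ball (.var _) (.imp
          (.lt hS.out.nonempty (.var _) (.const _)) (.bex (.var _) ((hQ.subst
            fun | 0 => .inl 0 | 1 => .inl 1 | i + 2 => .inr (v i)).congr
              fun v => ?_))))) ?_ ?_ a
      · exact iff_of_eq (congrArg Q (funext fun | 0 => rfl | 1 => rfl | i + 2 => rfl))
      · exact ⟨0, fun x hx => (not_lt_zero hx).elim⟩
      · rintro a ⟨b, hb⟩
        by_cases ha : a < v j
        · obtain ⟨y, hy⟩ := h a ha
          refine ⟨max b (y + 1), fun x hx hxj => ?_⟩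
          rcases ((lt_add_one_iff' S _ _).1 hx).lt_or_eq with hx | rfl
          · obtain ⟨z, hz, hQ⟩ := hb x hx hxj
            exact ⟨z, lt_max_of_lt_left hz, hQ⟩
          · exact ⟨y, lt_max_of_lt_right ((lt_add_one_iff' S _ _).2 le_rfl), hy⟩
        · refine ⟨b, fun x hx hxj => hb x ?_ hxj⟩
          exact hxj.trans_le (not_lt.1 ha)

end IsSigma1

/-! ### `Δ⁰₁` functions and predicates -/

/-- `F` is a function with a `Σ⁰₁` definable graph. -/
def IsD1Fun (S : Set (Set M)) (F : (ℕ → M) → M) : Prop :=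
  IsSigma1 S (fun w => w 0 = F (fun i => w (i + 1)))

/-- `P` is a `Δ⁰₁` predicate. -/
structure IsD1 (S : Set (Set M)) (P : (ℕ → M) → Prop) : Prop where
  sigma : IsSigma1 S P
  sigma_not : IsSigma1 S (fun v => ¬ P v)

theorem IsTerm.isD1Fun {F : (ℕ → M) → M} (h : IsTerm fun w : ℕ → M => F (fun i => w (i + 1))) :
    IsD1Fun S F :=
  (IsDelta0.eq hS.out.nonempty (.var 0) h).isSigma1

/-- The value of `F` is named by an existential quantifier. Because `F` is total, the same device
works for the negation, whence `IsD1.comp`. -/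
theorem IsSigma1.comp {P : M → (ℕ → M) → Prop} {F : (ℕ → M) → M}
    (hP : IsSigma1 S (fun w => P (w 0) (fun i => w (i + 1)))) (hF : IsD1Fun S F) :
    IsSigma1 S (fun v => P (F v) v) :=
  IsSigma1.congr (.ex (R := fun x v => x = F v ∧ P x v) (.and hF hP)) fun v => by simp

theorem IsD1.comp {P : M → (ℕ → M) → Prop} {F : (ℕ → M) → M}
    (hP : IsD1 S (fun w => P (w 0) (fun i => w (i + 1)))) (hF : IsD1Fun S F) :
    IsD1 S (fun v => P (F v) v) :=
  ⟨.comp hP.1 hF, .comp (P := fun x v => ¬ P x v) hP.2 hF⟩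

theorem IsDelta0.isD1 {P : (ℕ → M) → Prop} (h : IsDelta0 S P) : IsD1 S P :=
  ⟨h.isSigma1, h.not.isSigma1⟩

theorem IsD1.reindex {P : (ℕ → M) → Prop} (ρ : ℕ → ℕ) (h : IsD1 S P) :
    IsD1 S (fun v => P (fun i => v (ρ i))) :=
  ⟨h.1.reindex ρ, h.2.reindex ρ⟩

theorem IsD1Fun.reindex {F : (ℕ → M) → M} (ρ : ℕ → ℕ) (h : IsD1Fun S F) :
    IsD1Fun S (fun v => F (fun i => v (ρ i))) :=
  IsSigma1.reindex (liftRename ρ) h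

theorem IsD1Fun.shift {F : (ℕ → M) → M} (h : IsD1Fun S F) :
    IsD1Fun S (fun v => F (fun i => v (i + 1))) :=
  h.reindex _

theorem IsD1.comp₁ {P : M → Prop} {F : (ℕ → M) → M} (hP : IsD1 S (fun v => P (v 0)))
    (hF : IsD1Fun S F) : IsD1 S (fun v => P (F v)) :=
  IsD1.comp (P := fun x _ => P x) (hP.reindex id) hF

theorem IsD1.comp₂ {P : M → M → Prop} {F G : (ℕ → M) → M} (hP : IsD1 S (fun v => P (v 0) (v 1)))
    (hF : IsD1Fun S F) (hG : IsD1Fun S G) : IsD1 S (fun v => P (F v) (G v)) :=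
  IsD1.comp (P := fun x v => P x (G v)) (.comp (P := fun y v => P (v 0) y)
    (hP.reindex fun | 0 => 1 | _ => 0) hG.shift) hF

theorem IsD1.comp₃ {P : M → M → M → Prop} {F G H : (ℕ → M) → M}
    (hP : IsD1 S (fun v => P (v 0) (v 1) (v 2)))
    (hF : IsD1Fun S F) (hG : IsD1Fun S G) (hH : IsD1Fun S H) :
    IsD1 S (fun v => P (F v) (G v) (H v)) :=
  IsD1.comp (P := fun x v => P x (G v) (H v)) 
    (.comp (P := fun y v => P (v 0) y (H fun i => v (i + 1))) (.comp (P := fun z v => P (v 1) (v 0) z)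
    (hP.reindex fun | 0 => 2 | 1 => 1 | _ => 0) hH.shift.shift) hG.shift) hF

namespace IsD1

variable {P Q : (ℕ → M) → Prop} {F G : (ℕ → M) → M}

theorem congr (h : IsD1 S P) (e : ∀ v, P v ↔ Q v) : IsD1 S Q :=
  ⟨h.1.congr e, h.2.congr fun v => not_congr (e v)⟩

theorem not (h : IsD1 S P) : IsD1 S (fun v => ¬ P v) :=
  ⟨h.2, h.1.congr fun _ => not_not.symm⟩

theorem and (hP : IsD1 S P) (hQ : IsD1 S Q) : IsD1 S (fun v => P v ∧ Q v) :=
  ⟨hP.1.and hQ.1, (hP.2.or hQ.2).congr fun _ => not_and_or.symm⟩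

theorem or (hP : IsD1 S P) (hQ : IsD1 S Q) : IsD1 S (fun v => P v ∨ Q v) :=
  ⟨hP.1.or hQ.1, (hP.2.and hQ.2).congr fun _ => not_or.symm⟩

theorem imp (hP : IsD1 S P) (hQ : IsD1 S Q) : IsD1 S (fun v => P v → Q v) :=
  (hP.not.or hQ).congr fun _ => imp_iff_not_or.symm

theorem iff (hP : IsD1 S P) (hQ : IsD1 S Q) : IsD1 S (fun v => P v ↔ Q v) :=
  ((hP.imp hQ).and (hQ.imp hP)).congr fun _ => iff_iff_implies_and_implies.symm

theorem eq (hF : IsD1Fun S F) (hG : IsD1Fun S G) : IsD1 S (fun v => F v = G v) :=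
  comp₂ (P := fun x y => x = y) (IsDelta0.eq hS.out.nonempty (.var 0) (.var 1)).isD1 hF hG

theorem lt (hF : IsD1Fun S F) (hG : IsD1Fun S G) : IsD1 S (fun v => F v < G v) :=
  comp₂ (P := fun x y => x < y) (IsDelta0.lt hS.out.nonempty (.var 0) (.var 1)).isD1 hF hG

theorem le (hF : IsD1Fun S F) (hG : IsD1Fun S G) : IsD1 S (fun v => F v ≤ G v) :=
  (lt hG hF).not.congr fun _ => not_lt

theorem mem {A : Set M} (hA : A ∈ S) (hF : IsD1Fun S F) : IsD1 S (fun v => F v ∈ A) :=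
  comp₁ (P := fun x => x ∈ A) (IsDelta0.mem hA (.var 0)).isD1 hF

theorem bex {R : M → (ℕ → M) → Prop} (hF : IsD1Fun S F)
    (hR : IsD1 S (fun w => R (w 0) (fun i => w (i + 1)))) :
    IsD1 S (fun v => ∃ x, x < F v ∧ R x v) := by
  refine ⟨.ex (.and (lt (IsTerm.var _).isD1Fun hF.shift).1 hR.1), ?_⟩
  -- The bound `F v` is first replaced by a variable, the only kind of bound that collection was
  -- proved for.
  refine IsSigma1.congr (IsSigma1.comp (P := fun a v => ∀ x, x < a → ¬ R x v) ?_ hF)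
    fun v => ?_
  · exact IsSigma1.ball_var (R := fun x w => ¬ R x (fun i => w (i + 1)))
      (hR.2.reindex fun | 0 => 0 | i + 1 => i + 2) 0
  · push Not
    rfl

theorem ball {R : M → (ℕ → M) → Prop} (hF : IsD1Fun S F)
    (hR : IsD1 S (fun w => R (w 0) (fun i => w (i + 1)))) :
    IsD1 S (fun v => ∀ x, x < F v → R x v) :=
  (bex (R := fun x v => ¬ R x v) hF hR.not).not.congr fun v => by push Not; rfl

end IsD1

namespace IsD1Fun

variable {F G : (ℕ → M) → M}

theorem var (i : ℕ) : IsD1Fun S (fun v => v i) := (IsTerm.var _).isD1Fun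

theorem const (a : M) : IsD1Fun S (fun _ => a) := (IsTerm.const _).isD1Fun

theorem comp {H : M → (ℕ → M) → M} (hH : IsD1Fun S (fun w => H (w 0) (fun i => w (i + 1))))
    (hF : IsD1Fun S F) : IsD1Fun S (fun v => H (F v) v) :=
  IsSigma1.comp (P := fun x w => w 0 = H x (fun i => w (i + 1)))
    ((IsSigma1.reindex (fun | 0 => 1 | 1 => 0 | i + 2 => i + 2) hH).congr fun _ => Iff.rfl) hF.shift

theorem comp₁ {H : M → M} (hH : IsD1Fun S (fun v => H (v 0))) (hF : IsD1Fun S F) :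
    IsD1Fun S (fun v => H (F v)) :=
  comp (H := fun x _ => H x) (hH.reindex id) hF

theorem comp₂ {H : M → M → M} (hH : IsD1Fun S (fun v => H (v 0) (v 1)))
    (hF : IsD1Fun S F) (hG : IsD1Fun S G) : IsD1Fun S (fun v => H (F v) (G v)) :=
  comp (H := fun x v => H x (G v)) (.comp (H := fun y v => H (v 0) y)
    (hH.reindex fun | 0 => 1 | _ => 0) hG.shift) hF

theorem comp₃ {H : M → M → M → M} {K : (ℕ → M) → M}
    (hH : IsD1Fun S (fun v => H (v 0) (v 1) (v 2)))
    (hF : IsD1Fun S F) (hG : IsD1Fun S G) (hK : IsD1Fun S K) :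
    IsD1Fun S (fun v => H (F v) (G v) (K v)) :=
  comp (H := fun x v => H x (G v) (K v)) (.comp (H := fun y v => H (v 0) y (K fun i => v (i + 1)))
    (.comp (H := fun z v => H (v 1) (v 0) z)
    (hH.reindex fun | 0 => 2 | 1 => 1 | _ => 0) hK.shift.shift) hG.shift) hF

theorem add (hF : IsD1Fun S F) (hG : IsD1Fun S G) : IsD1Fun S (fun v => F v + G v) :=
  comp₂ (H := fun x y => x + y) (IsTerm.add (.var _) (.var _)).isD1Fun hF hG

theorem mul (hF : IsD1Fun S F) (hG : IsD1Fun S G) : IsD1Fun S (fun v => F v * G v) :=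
  comp₂ (H := fun x y => x * y) (IsTerm.mul (.var _) (.var _)).isD1Fun hF hG

theorem of_isD1 (h : IsD1 S (fun w => w 0 = F (fun i => w (i + 1)))) : IsD1Fun S F := h.1

end IsD1Fun

theorem IsD1.bexLe {R : M → (ℕ → M) → Prop} {F : (ℕ → M) → M} (hF : IsD1Fun S F)
    (hR : IsD1 S (fun w => R (w 0) (fun i => w (i + 1)))) :
    IsD1 S (fun v => ∃ x, x ≤ F v ∧ R x v) :=
  (bex (hF.add (.const 1)) hR).congr fun v => by simp only [lt_add_one_iff' S]

theorem IsD1.ballLe {R : M → (ℕ → M) → Prop} {F : (ℕ → M) → M} (hF : IsD1Fun S F)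
    (hR : IsD1 S (fun w => R (w 0) (fun i => w (i + 1)))) :
    IsD1 S (fun v => ∀ x, x ≤ F v → R x v) :=
  (ball (hF.add (.const 1)) hR).congr fun v => by simp only [lt_add_one_iff' S]

/-! ### Induction and comprehension -/

theorem IsSigma1.induct {P : M → Prop} (hP : IsSigma1 S (fun v => P (v 0))) (zero : P 0)
    (succ : ∀ x, P x → P (x + 1)) : ∀ x, P x :=
  hS.out.induction.induct hP zero succ

theorem IsD1.induct {P : M → Prop} (hP : IsD1 S (fun v => P (v 0))) (zero : P 0)
    (succ : ∀ x, P x → P (x + 1)) : ∀ x, P x :=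
  hP.1.induct zero succ

/-- Induction for `Π⁰₁` predicates. -/
theorem IsSigma1.induct_not {P : M → Prop} (hP : IsSigma1 S (fun v => ¬ P (v 0))) (zero : P 0)
    (succ : ∀ x, P x → P (x + 1)) (a : M) : P a := by
  by_contra ha
  -- A counterexample at `a` descends one step at a time; after `k` steps it sits at `z` with `z + k
  -- = a`, and at `k = a` it contradicts the case `0`. The alternative `a < k` covers the steps
  -- beyond.
  have : ∀ k, ∃ z, a < k ∨ (z + k = a ∧ ¬ P z) := by
    refine IsSigma1.induct (S := S) (.ex (.or (IsD1.lt (.const _) (.var _)).1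
      (.and (IsD1.eq (.add (.var _) (.var _)) (.const _)).1 (hP.reindex fun _ => 0))))
      ⟨a, .inr ⟨add_zero a, ha⟩⟩ ?_
    rintro k ⟨z, hz | ⟨hz, hPz⟩⟩
    · exact ⟨0, .inl (hz.trans ((lt_add_one_iff' S _ _).2 le_rfl))⟩
    · rcases eq_zero_or_pos z with rfl | h
      · exact (hPz zero).elim
      · obtain ⟨y, rfl⟩ := (hS.out.lt_iff_exists 0 z).1 h
        rw [zero_add] at hPz hz
        exact ⟨y, .inr ⟨by rw [← hz]; ring, fun h => hPz (succ y h)⟩⟩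
  obtain ⟨z, hz | ⟨hz, hPz⟩⟩ := this a
  · exact hz.false
  · obtain rfl : z = 0 := by simpa using hz
    exact hPz zero

theorem IsD1.exists_least {P : M → Prop} (hP : IsD1 S (fun v => P (v 0))) (h : ∃ x, P x) :
    ∃ x, P x ∧ ∀ y, y < x → ¬ P y := by
  by_contra hn
  push Not at hn
  have : ∀ x, ∀ y, y < x → ¬ P y := by
    refine IsD1.induct (S := S) (.ball (.var _) (hP.reindex fun _ => 0).not) (by simp) ?_
    intro x ih y hy hPy
    obtain ⟨z, hz, hPz⟩ := hn y hPy
    exact ih z (hz.trans_le ((lt_add_one_iff' S _ _).1 hy)) hPz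
  obtain ⟨x, hx⟩ := h
  exact this (x + 1) x ((lt_add_one_iff' S _ _).2 le_rfl) hx

/-- Choice of values for a `Δ⁰₁` relation. -/
theorem IsD1.exists_choice {P : M → M → Prop} (hP : IsD1 S (fun v => P (v 0) (v 1)))
    (h : ∀ x, ∃ y, P x y) : ∃ F : M → M, IsD1Fun S (fun v => F (v 0)) ∧ ∀ x, P x (F x) := by
  -- Taking least witnesses determines the function and makes its graph `Δ⁰₁`.
  have : ∀ x, ∃ y, P x y ∧ ∀ z, z < y → ¬ P x z := fun x =>
    IsD1.exists_least (hP.comp₂ (.const x) (.var _)) (h x)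
  choose F hF hF' using this
  refine ⟨F, .of_isD1 (.congr (P := fun w => P (w 1) (w 0) ∧ ∀ z, z < w 0 → ¬ P (w 1) z) ?_
    fun w => ?_), hF⟩
  · exact .and (hP.comp₂ (.var _) (.var _)) (.ball (.var _) (hP.comp₂ (.var _) (.var _)).not)
  · constructor
    · rintro ⟨h1, h2⟩
      exact le_antisymm (not_lt.1 fun hlt => h2 _ hlt (hF _)) (not_lt.1 fun hlt => hF' _ _ hlt h1)
    · intro e
      rw [e]
      exact ⟨hF _, hF' _⟩

theorem IsD1.mem_of {P : M → Prop} (hP : IsD1 S (fun v => P (v 0))) : {x | P x} ∈ S :=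
  hS.out.comprehension.setOf_mem hP.1 hP.2

end OrderedSemiring

/-! ### Pairing, and Gödel coding of finite sets by divisibility -/

section Coding

variable {M : Type*} [CommSemiring M] [LinearOrder M] [IsStrictOrderedRing M]
  [CanonicallyOrderedAdd M] {S : Set (Set M)} [hS : Fact (ModelsRCA0 S)]

/-! ### Pairs -/

omit [IsStrictOrderedRing M] [CanonicallyOrderedAdd M] in
include hS in
variable (S) in
theorem add_one_le_iff' (x y : M) : x + 1 ≤ y ↔ x < y := by
  rw [← not_lt, lt_add_one_iff' S, not_le]

include hS in
variable (S) in
theorem one_le_of_ne_zero {x : M} (h : x ≠ 0) : 1 ≤ x := by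
  have := (add_one_le_iff' S 0 x).2 (pos_iff_ne_zero.2 h)
  rwa [zero_add] at this

include hS in
variable (S) in
theorem le_mul_self' (x : M) : x ≤ x * x := by
  rcases eq_or_ne x 0 with rfl | h
  · simp
  · exact le_mul_of_one_le_left (zero_le) (one_le_of_ne_zero S h)

include hS in
variable (S) in
theorem left_le_pair (i j : M) : i ≤ pair i j := le_add_self

include hS in
variable (S) in
theorem right_le_pair (i j : M) : j ≤ pair i j :=
  (le_add_self.trans (le_mul_self' S (i + j))).trans le_self_add

theorem pair_le_pair {i j i' j' : M} (hi : i ≤ i') (hj : j ≤ j') : pair i j ≤ pair i' j' := by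
  unfold pair
  gcongr

include hS in
variable (S) in
-- The number `pair i j` lies in the interval from `(i + j)²` up to, but excluding, `(i + j + 1)²`,
-- so it determines `i + j`.
theorem add_le_of_pair_eq {i j i' j' : M} (h : pair i j = pair i' j') : i' + j' ≤ i + j := by
  by_contra hlt
  have h1 := (add_one_le_iff' S _ _).2 (not_le.1 hlt)
  have h2 : (i + j + 1) * (i + j + 1) ≤ (i' + j') * (i' + j') := by gcongr
  have h3 : pair i j < (i + j + 1) * (i + j + 1) := by
    have : (i + j + 1) * (i + j + 1) = pair i j + (i + j + j + 1) := by unfold pair; ring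
    rw [this]
    exact lt_add_of_pos_right _ (pos_iff_ne_zero.2 (by simp))
  exact absurd h ((h3.trans_le h2).trans_le le_self_add).ne

include hS in
variable (S) in
theorem pair_inj {i j i' j' : M} : pair i j = pair i' j' ↔ i = i' ∧ j = j' := by
  refine ⟨fun h => ?_, fun ⟨h1, h2⟩ => by rw [h1, h2]⟩
  have e := (add_le_of_pair_eq S h.symm).antisymm (add_le_of_pair_eq S h)
  unfold pair at h
  rw [e] at h
  have h1 := add_left_cancel h
  rw [h1] at e
  exact ⟨h1, add_left_cancel e⟩

theorem IsD1Fun.pair {F G : (ℕ → M) → M} (hF : IsD1Fun S F) (hG : IsD1Fun S G) :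
    IsD1Fun S (fun v => pair (F v) (G v)) :=
  ((hF.add hG).mul (hF.add hG)).add hF

/-! ### Divisibility -/

/-- There is no subtraction, so the quotients of `b` and `b + c` are compared instead; if the second
is not the larger, then `c = 0`. -/
theorem dvd_of_dvd_add {a b c : M} (hb : a ∣ b) (h : a ∣ b + c) : a ∣ c := by
  obtain ⟨x, rfl⟩ := hb
  obtain ⟨y, hy⟩ := h
  rcases le_total x y with hxy | hxy
  · obtain ⟨w, rfl⟩ := exists_add_of_le hxy
    rw [mul_add] at hy
    exact ⟨w, add_left_cancel hy⟩
  · have h1 : a * x + c ≤ a * x + 0 := by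
      rw [hy, add_zero]
      gcongr
    have h2 : c = 0 := nonpos_iff_eq_zero.1 (le_of_add_le_add_left h1)
    rw [h2]
    exact dvd_zero a

include hS in
variable (S) in
theorem le_of_dvd' {a b : M} (hb : b ≠ 0) (h : a ∣ b) : a ≤ b := by
  obtain ⟨c, rfl⟩ := h
  exact le_mul_of_one_le_right zero_le (one_le_of_ne_zero S (right_ne_zero_of_mul hb))

theorem IsD1.dvd {F G : (ℕ → M) → M} (hF : IsD1Fun S F) (hG : IsD1Fun S G) :
    IsD1 S (fun v => F v ∣ G v) := by
  refine .congr (.or (.eq hG (.const 0)) (.bexLe hG (R := fun q v => G v = F v * q)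
    (.eq hG.shift (hF.shift.mul (.var _))))) fun v => ?_
  constructor
  · rintro (h | ⟨q, -, h⟩)
    · rw [h]
      exact dvd_zero _
    · exact ⟨q, h⟩
  · rintro ⟨q, h⟩
    by_cases h0 : G v = 0
    · exact .inl h0
    · refine .inr ⟨q, ?_, h⟩
      exact le_of_dvd' S h0 (h ▸ dvd_mul_left _ _)

/-- `m` is divisible by all positive numbers up to `l`, and the nonzero number `N` is divisible by
all `m (i + 1) + 1` with `i < l`. -/
def IsBase (l m N : M) : Prop :=
  m ≠ 0 ∧ N ≠ 0 ∧ ∀ i, i < l → i + 1 ∣ m ∧ m * (i + 1) + 1 ∣ N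

variable (S) in
include hS in
-- Factorials and products are not terms, so the running products are obtained by `Σ⁰₁` induction:
-- first of the `i + 1` for `m`, then of the moduli for `N`.
theorem exists_isBase (l : M) : ∃ m N, IsBase l m N := by
  have h1 : ∀ l : M, ∃ m, m ≠ 0 ∧ ∀ i, i < l → i + 1 ∣ m := by
    refine IsSigma1.induct (S := S) (.ex (IsD1.and (.not (.eq (.var _) (.const _)))
      (.ball (.var _) (.dvd (.add (.var _) (.const _)) (.var _)))).1)
      ⟨1, one_ne_zero, fun i hi => (not_lt_zero hi).elim⟩ ?_
    rintro l ⟨m, hm, h⟩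
    refine ⟨m * (l + 1), mul_ne_zero hm (by simp), fun i hi => ?_⟩
    rcases ((lt_add_one_iff' S _ _).1 hi).lt_or_eq with hi | rfl
    · exact (h i hi).mul_right _
    · exact dvd_mul_left _ _
  obtain ⟨m, hm, h⟩ := h1 l
  have h2 : ∀ l : M, ∃ N, N ≠ 0 ∧ ∀ i, i < l → m * (i + 1) + 1 ∣ N := by
    refine IsSigma1.induct (S := S) (.ex (IsD1.and (.not (.eq (.var _) (.const _)))
      (.ball (.var _) (.dvd (.add (.mul (.const _) (.add (.var _) (.const _))) (.const _))
        (.var _)))).1)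
      ⟨1, one_ne_zero, fun i hi => (not_lt_zero hi).elim⟩ ?_
    rintro l ⟨N, hN, h⟩
    refine ⟨N * (m * (l + 1) + 1), mul_ne_zero hN (by simp), fun i hi => ?_⟩
    rcases ((lt_add_one_iff' S _ _).1 hi).lt_or_eq with hi | rfl
    · exact (h i hi).mul_right _
    · exact dvd_mul_left _ _
  obtain ⟨N, hN, h'⟩ := h2 l
  exact ⟨m, N, hm, hN, fun i hi => ⟨h i hi, h' i hi⟩⟩

/-- The modulus times `z` equals `m * (i + 1) * z + z`, and the first summand is divisible by
assumption. -/
theorem modulus_coprime_base {m i z : M} (h : m * (i + 1) + 1 ∣ m * z) : m * (i + 1) + 1 ∣ z := by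
  have h1 : m * (i + 1) + 1 ∣ m * (i + 1) * z + z := ⟨z, by ring⟩
  refine dvd_of_dvd_add (Dvd.dvd.trans (h.mul_right (i + 1)) ?_) h1
  exact dvd_of_eq (by ring)

theorem modulus_coprime_diff {m i d z : M} (hd : d ∣ m) (h : m * (i + 1) + 1 ∣ m * d * z) :
    m * (i + 1) + 1 ∣ z := by
  obtain ⟨c, hc⟩ := hd
  have h1 : m * (i + 1) + 1 ∣ d * z := modulus_coprime_base (by rwa [← mul_assoc])
  refine modulus_coprime_base ((h1.mul_right c).trans (dvd_of_eq ?_))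
  rw [mul_right_comm, ← hc]

variable (S) in
include hS in
-- Two moduli differ by `m * (d + 1)` with `d + 1` a divisor of `m`, and a modulus can be cancelled
-- against both factors.
theorem IsBase.coprime {l m N i j z : M} (h : IsBase l m N) (hi : i < l) (hj : j < l)
    (hij : i ≠ j) (hz : m * (i + 1) + 1 ∣ (m * (j + 1) + 1) * z) : m * (i + 1) + 1 ∣ z := by
  have hd : ∀ {i j d}, j = i + d + 1 → j < l → d + 1 ∣ m := by
    rintro i j d rfl hj
    refine (h.2.2 d (lt_of_le_of_lt ?_ hj)).1
    rw [add_assoc, add_left_comm]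
    exact le_self_add
  rcases hij.lt_or_gt with hlt | hlt
  · obtain ⟨d, hd'⟩ := (hS.out.lt_iff_exists _ _).1 hlt
    refine modulus_coprime_diff (hd hd' hj) (dvd_of_dvd_add (dvd_mul_right _ z) (hz.trans ?_))
    rw [hd']
    exact dvd_of_eq (by ring)
  · obtain ⟨d, hd'⟩ := (hS.out.lt_iff_exists _ _).1 hlt
    refine modulus_coprime_diff (hd hd' hi) (dvd_of_dvd_add hz ((dvd_mul_right _ z).trans ?_))
    rw [hd']
    exact dvd_of_eq (by ring)

variable (S) in
include hS in
-- The code is the product of the moduli at the places in `P`, built up one factor at a time. That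
-- it divides `N` bounds it independently of `P`.
theorem IsBase.exists_code {l m N : M} (h : IsBase l m N) {P : M → Prop}
    (hP : IsD1 S (fun v => P (v 0))) :
    ∃ n, n ∣ N ∧ ∀ i, i < l → (m * (i + 1) + 1 ∣ n ↔ P i) := by
  -- For places not yet used the induction carries cancellation, a form of coprimality with `n`;
  -- bounding `z` by `N` keeps the statement `Σ⁰₁`.
  have main : ∀ k, ∃ n, n ∣ N ∧ ∀ i, i < l → ((i < k ∧ P i) → m * (i + 1) + 1 ∣ n) ∧
      (¬ (i < k ∧ P i) → ∀ z, z ≤ N → m * (i + 1) + 1 ∣ n * z → m * (i + 1) + 1 ∣ z) := by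
    refine IsSigma1.induct (S := S) (.ex (IsD1.and (.dvd (.var _) (.const _)) (.ball (.const _)
      (.and (.imp (.and (.lt (.var _) (.var _)) (hP.comp₁ (.var _)))
        (.dvd (.add (.mul (.const _) (.add (.var _) (.const _))) (.const _)) (.var _)))
      (.imp (.not (.and (.lt (.var _) (.var _)) (hP.comp₁ (.var _)))) (.ballLe (.const _)
        (.imp (.dvd (.add (.mul (.const _) (.add (.var _) (.const _))) (.const _))
          (.mul (.var _) (.var _)))
          (.dvd (.add (.mul (.const _) (.add (.var _) (.const _))) (.const _)) (.var _)))))))).1)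
      ⟨1, one_dvd _, fun i _ => ⟨fun hi => (not_lt_zero hi.1).elim, fun _ z _ hz => by
        rwa [one_mul] at hz⟩⟩ ?_
    rintro k ⟨n, hn, hk⟩
    by_cases hkP : k < l ∧ P k
    · obtain ⟨q, rfl⟩ := hn
      -- The new modulus divides `N = n * q` and cancels against `n`, so it divides the cofactor
      -- `q`; hence `n` times it still divides `N`.
      obtain ⟨r, rfl⟩ := (hk k hkP.1).2 (fun hkk => hkk.1.false) q
        (le_mul_of_one_le_left zero_le (one_le_of_ne_zero S (left_ne_zero_of_mul h.2.1)))
        (h.2.2 k hkP.1).2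
      refine ⟨n * (m * (k + 1) + 1), ⟨r, by ring⟩, fun i hi =>
        ⟨fun hik => ?_, fun hik z hz hd => ?_⟩⟩
      · rcases ((lt_add_one_iff' S _ _).1 hik.1).lt_or_eq with hlt | rfl
        · exact ((hk i hi).1 ⟨hlt, hik.2⟩).mul_right _
        · exact dvd_mul_left _ _
      · refine (hk i hi).2 (fun hlt => hik ⟨hlt.1.trans ((lt_add_one_iff' S _ _).2 le_rfl), hlt.2⟩)
          z hz (h.coprime S hi hkP.1 ?_ (hd.trans (dvd_of_eq (by ring))))
        rintro rfl
        exact hik ⟨(lt_add_one_iff' S _ _).2 le_rfl, hkP.2⟩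
    · refine ⟨n, hn, fun i hi => ?_⟩
      have : (i < k + 1 ∧ P i) ↔ (i < k ∧ P i) := by
        refine and_congr_left fun hPi => ?_
        rw [lt_add_one_iff' S, le_iff_lt_or_eq, or_iff_left]
        rintro rfl
        exact hkP ⟨hi, hPi⟩
      rw [this]
      exact hk i hi
  obtain ⟨n, hn, hk⟩ := main l
  refine ⟨n, hn, fun i hi => ⟨fun hd => ?_, fun hPi => (hk i hi).1 ⟨hi, hPi⟩⟩⟩
  by_contra hPi
  have h1 := (hk i hi).2 (fun hik => hPi hik.2) 1 (one_le_of_ne_zero S h.2.1) (by rwa [mul_one])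
  have h2 := le_of_dvd' S one_ne_zero h1
  have h3 : m * (i + 1) + 1 ≤ 0 + 1 := by rwa [zero_add]
  exact mul_ne_zero h.1 (by simp : i + 1 ≠ 0) (nonpos_iff_eq_zero.1 (le_of_add_le_add_right h3))

end Coding

/-! ### Strings as objects of the model, primitive recursion, pigeonhole -/

section Strings

variable {M : Type*} [CommSemiring M] [LinearOrder M] [IsStrictOrderedRing M]
  [CanonicallyOrderedAdd M] {S : Set (Set M)} [hS : Fact (ModelsRCA0 S)]

/-! ### Descriptions of strings -/

include hS in
variable (S) in
theorem HasLength.unique {x l l' : M} (h : HasLength x l) (h' : HasLength x l') : l = l' := by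
  obtain ⟨m, n, rfl⟩ := h
  obtain ⟨m', n', h'⟩ := h'
  exact ((pair_inj S).1 h').1

include hS in
variable (S) in
theorem HasLength.le {x l : M} (h : HasLength x l) : l ≤ x := by
  obtain ⟨m, n, rfl⟩ := h
  exact left_le_pair S _ _

include hS in
variable (S) in
theorem digitOne_pair {l m n i : M} :
    DigitOne (pair l (pair m n)) i ↔ i < l ∧ m * (i + 1) + 1 ∣ n := by
  constructor
  · rintro ⟨l', m', n', h, hi, hd⟩
    obtain ⟨rfl, h'⟩ := (pair_inj S).1 h
    obtain ⟨rfl, rfl⟩ := (pair_inj S).1 h'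
    exact ⟨hi, hd⟩
  · rintro ⟨hi, hd⟩
    exact ⟨l, m, n, rfl, hi, hd⟩

include hS in
variable (S) in
theorem DigitOne.lt {x l i : M} (h : DigitOne x i) (hl : HasLength x l) : i < l := by
  obtain ⟨m, n, rfl⟩ := hl
  exact ((digitOne_pair S).1 h).1

include hS in
variable (S) in
theorem DigitOne.lt_self {x i : M} (h : DigitOne x i) : i < x := by
  have h' := h
  obtain ⟨l, m, n, rfl, hi, -⟩ := h'
  exact hi.trans_le (left_le_pair S _ _)

theorem IsD1.hasLength {F G : (ℕ → M) → M} (hF : IsD1Fun S F) (hG : IsD1Fun S G) :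
    IsD1 S (fun v => HasLength (F v) (G v)) := by
  refine .congr (P := fun v => ∃ m, m ≤ F v ∧ ∃ n, n ≤ F v ∧ F v = pair (G v) (pair m n))
    (.bexLe hF (.bexLe hF.shift (.eq hF.shift.shift
      (.pair hG.shift.shift (.pair (.var _) (.var _)))))) fun v => ?_
  constructor
  · rintro ⟨m, -, n, -, h⟩
    exact ⟨m, n, h⟩
  · rintro ⟨m, n, h⟩
    refine ⟨m, ?_, n, ?_, h⟩ <;> rw [h]
    · exact (left_le_pair S _ _).trans (right_le_pair S _ _)
    · exact (right_le_pair S _ _).trans (right_le_pair S _ _)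

theorem IsD1.digitOne {F G : (ℕ → M) → M} (hF : IsD1Fun S F) (hG : IsD1Fun S G) :
    IsD1 S (fun v => DigitOne (F v) (G v)) := by
  refine .comp₂ (P := DigitOne) (.congr (P := fun v => ∃ l, l ≤ v 0 ∧ ∃ m, m ≤ v 0 ∧ ∃ n, n ≤ v 0 ∧
      v 0 = pair l (pair m n) ∧ v 1 < l ∧ m * (v 1 + 1) + 1 ∣ n)
    (.bexLe (.var _) (.bexLe (.var _) (.bexLe (.var _) (.and
      (.eq (.var _) (.pair (.var _) (.pair (.var _) (.var _)))) (.and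
        (.lt (.var _) (.var _)) (.dvd (.add (.mul (.var _) (.add (.var _) (.const _))) (.const _))
          (.var _))))))) fun v => ?_) hF hG
  constructor
  · rintro ⟨l, -, m, -, n, -, h⟩
    exact ⟨l, m, n, h⟩
  · rintro ⟨l, m, n, h⟩
    refine ⟨l, ?_, m, ?_, n, ?_, h⟩ <;> rw [h.1]
    · exact left_le_pair S _ _
    · exact (left_le_pair S _ _).trans (right_le_pair S _ _)
    · exact (right_le_pair S _ _).trans (right_le_pair S _ _)

theorem IsD1.sameString {F G : (ℕ → M) → M} (hF : IsD1Fun S F) (hG : IsD1Fun S G) :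
    IsD1 S (fun v => SameString (F v) (G v)) := by
  refine .comp₂ (P := SameString) (.congr (P := fun v =>
      (∃ l, l ≤ v 0 ∧ HasLength (v 0) l ∧ HasLength (v 1) l) ∧
        (∀ i, i < v 0 → (DigitOne (v 0) i ↔ DigitOne (v 1) i)) ∧
          ∀ i, i < v 1 → (DigitOne (v 0) i ↔ DigitOne (v 1) i)) (.and
    (.bexLe (.var _) (.and (.hasLength (.var _) (.var _)) (.hasLength (.var _) (.var _))))
    (.and (.ball (.var _) (.iff (.digitOne (.var _) (.var _)) (.digitOne (.var _) (.var _))))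
      (.ball (.var _) (.iff (.digitOne (.var _) (.var _)) (.digitOne (.var _) (.var _))))))
    fun v => ?_) hF hG
  constructor
  · rintro ⟨⟨l, -, h⟩, h0, h1⟩
    exact ⟨⟨l, h⟩, fun i => ⟨fun hi => (h0 i (hi.lt_self S)).1 hi,
      fun hi => (h1 i (hi.lt_self S)).2 hi⟩⟩
  · rintro ⟨⟨l, h⟩, h0⟩
    exact ⟨⟨l, h.1.le S, h⟩, fun i _ => h0 i, fun i _ => h0 i⟩

theorem IsD1.isString {F : (ℕ → M) → M} (hF : IsD1Fun S F) :
    IsD1 S (fun v => IsString (F v)) := by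
  refine .comp₁ (P := IsString) (.congr (P := fun v =>
      (∃ l, l ≤ v 0 ∧ HasLength (v 0) l) ∧ ∀ y, y < v 0 → ¬ SameString y (v 0))
    (.and (.bexLe (.var _) (.hasLength (.var _) (.var _)))
      (.ball (.var _) (.not (.sameString (.var _) (.var _))))) fun v => ?_) hF
  constructor
  · rintro ⟨⟨l, -, h⟩, h0⟩
    exact ⟨⟨l, h⟩, h0⟩
  · rintro ⟨⟨l, h⟩, h0⟩
    exact ⟨⟨l, h.le S, h⟩, h0⟩

variable (S) in
include hS in
theorem exists_code {P : M → Prop} (hP : IsD1 S (fun v => P (v 0))) (l : M) :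
    ∃ c, HasLength c l ∧ ∀ i, DigitOne c i ↔ i < l ∧ P i := by
  obtain ⟨m, N, h⟩ := exists_isBase S l
  obtain ⟨n, -, hn⟩ := h.exists_code S hP
  refine ⟨pair l (pair m n), ⟨m, n, rfl⟩, fun i => ?_⟩
  rw [digitOne_pair S]
  exact and_congr_right (hn i)

include hS in
variable (S) in
theorem SameString.trans {x y z : M} (h : SameString x y) (h' : SameString y z) :
    SameString x z := by
  obtain ⟨⟨l, h1, h2⟩, h3⟩ := h
  obtain ⟨⟨l', h1', h2'⟩, h3'⟩ := h'
  obtain rfl := h2.unique S h1'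
  exact ⟨⟨l, h1, h2'⟩, fun i => (h3 i).trans (h3' i)⟩

include hS in
variable (S) in
/-- Every description can be replaced by the code of the same string. -/
theorem exists_isString_sameString {x l : M} (h : HasLength x l) :
    ∃ σ, IsString σ ∧ SameString σ x ∧ σ ≤ x := by
  have hx : SameString x x := ⟨⟨l, h, h⟩, fun _ => Iff.rfl⟩
  obtain ⟨σ, hσ, hmin⟩ := IsD1.exists_least (S := S) (P := fun y => SameString y x)
    (.sameString (.var 0) (.const _)) ⟨x, hx⟩
  exact ⟨σ, ⟨hσ.1.imp fun _ h => h.1, fun y hy hyσ => hmin y hy (hyσ.trans S hσ)⟩, hσ,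
    not_lt.1 fun hlt => hmin x hlt hx⟩

variable (S) in
include hS in
theorem exists_isString {P : M → Prop} (hP : IsD1 S (fun v => P (v 0))) (l : M) :
    ∃ σ, IsString σ ∧ HasLength σ l ∧ ∀ i, i < l → (DigitOne σ i ↔ P i) := by
  obtain ⟨c, hc, h⟩ := exists_code S hP l
  obtain ⟨σ, hσ, ⟨⟨l', hl, hl'⟩, hs⟩, -⟩ := exists_isString_sameString S hc
  obtain rfl := hl'.unique S hc
  exact ⟨σ, hσ, hl, fun i hi => by rw [hs, h, and_iff_right hi]⟩

variable (S) in
include hS in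
/-- The codes of the strings of a given length are bounded. -/
theorem exists_string_bound : ∃ B : M → M, IsD1Fun S (fun v => B (v 0)) ∧
    ∀ l σ, IsString σ → HasLength σ l → σ < B l := by
  obtain ⟨B, hB, h⟩ := IsD1.exists_choice (S := S) (P := fun l b => ∃ m, m ≤ b ∧ ∃ N, N ≤ b ∧
    b = pair l (pair m N) + 1 ∧ m ≠ 0 ∧ N ≠ 0 ∧ ∀ i, i < l → i + 1 ∣ m ∧ m * (i + 1) + 1 ∣ N)
    (.bexLe (.var _) (.bexLe (.var _) (.and (.eq (.var _) (.add (.pair (.var _)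
      (.pair (.var _) (.var _))) (.const _))) (.and (.not (.eq (.var _) (.const _)))
        (.and (.not (.eq (.var _) (.const _))) (.ball (.var _) (.and
          (.dvd (.add (.var _) (.const _)) (.var _))
          (.dvd (.add (.mul (.var _) (.add (.var _) (.const _))) (.const _)) (.var _)))))))))
    fun l => by
      obtain ⟨m, N, h⟩ := exists_isBase S l
      exact ⟨_, m, ((left_le_pair S _ _).trans (right_le_pair S _ _)).trans le_self_add,
        N, ((right_le_pair S _ _).trans (right_le_pair S _ _)).trans le_self_add, rfl, h⟩
  refine ⟨B, hB, fun l σ hσ hl => ?_⟩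
  obtain ⟨m, -, N, -, e, hbase⟩ := h l
  -- The string has a description with this `m` and a divisor `n ≤ N`; its code, the least
  -- description, is no larger.
  obtain ⟨n, hn, hd⟩ := IsBase.exists_code S hbase (P := DigitOne σ) (.digitOne (.const _) (.var _))
  rw [e, lt_add_one_iff' S]
  have hle : pair l (pair m n) ≤ pair l (pair m N) :=
    pair_le_pair le_rfl (pair_le_pair le_rfl (le_of_dvd' S hbase.2.1 hn))
  refine (not_lt.1 fun hlt => hσ.2 _ hlt ?_).trans hle
  refine ⟨⟨l, ⟨m, n, rfl⟩, hl⟩, fun i => ?_⟩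
  rw [digitOne_pair S]
  exact ⟨fun h => (hd i h.1).1 h.2, fun h => ⟨h.lt S hl, (hd i (h.lt S hl)).2 h⟩⟩

/-! ### Definition by recursion -/

/-- The set of pairs coded by `c` consists of values of the function defined by recursion from
`init` and `G` with parameter `a`. -/
def IsJustified (init : M → M) (G : M → M → M → M) (a c : M) : Prop :=
  ∀ k, k < c → ∀ x, x < c → DigitOne c (pair k x) → (k = 0 ∧ x = init a) ∨
    ∃ k', k' < c ∧ ∃ x', x' < c ∧ DigitOne c (pair k' x') ∧ k = k' + 1 ∧ x = G a k' x'

theorem IsD1.isJustified {init : M → M} {G : M → M → M → M} (h0 : IsD1Fun S fun v => init (v 0))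
    (h1 : IsD1Fun S fun v => G (v 0) (v 1) (v 2)) {F H : (ℕ → M) → M} (hF : IsD1Fun S F)
    (hH : IsD1Fun S H) : IsD1 S (fun v => IsJustified init G (F v) (H v)) :=
  .comp₂ (P := IsJustified init G) (.ball (.var _) (.ball (.var _) (.imp
    (.digitOne (.var _) (.pair (.var _) (.var _))) (.or (.and (.eq (.var _) (.const _))
      (.eq (.var _) (h0.comp₁ (.var _)))) (.bex (.var _) (.bex (.var _) (.and
        (.digitOne (.var _) (.pair (.var _) (.var _))) (.and (.eq (.var _)
          (.add (.var _) (.const _))) (.eq (.var _)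
            (h1.comp₃ (.var _) (.var _) (.var _))))))))))) hF hH

include hS in
variable (S) in
theorem IsJustified.unique {init : M → M} {G : M → M → M → M} {a c c' : M}
    (h : IsJustified init G a c) (h' : IsJustified init G a c') : ∀ k,
    ∀ x, x < c → ∀ x', x' < c' → DigitOne c (pair k x) → DigitOne c' (pair k x') → x = x' := by
  have lt : ∀ {d k x : M}, DigitOne d (pair k x) → k < d := fun hd =>
    (left_le_pair S _ _).trans_lt (hd.lt_self S)
  refine IsD1.induct (S := S) (.ball (.const _) (.ball (.const _) (.imp
    (.digitOne (.const _) (.pair (.var _) (.var _))) (.imp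
    (.digitOne (.const _) (.pair (.var _) (.var _))) (.eq (.var _) (.var _)))))) ?_ ?_
  · intro x hx x' hx' hd hd'
    rcases h 0 (lt hd) x hx hd with ⟨-, rfl⟩ | ⟨k, -, y, -, -, e, -⟩
    · rcases h' 0 (lt hd') x' hx' hd' with ⟨-, rfl⟩ | ⟨k, -, y, -, -, e, -⟩
      · rfl
      · exact (hS.out.basic.succ_ne_zero _ e.symm).elim
    · exact (hS.out.basic.succ_ne_zero _ e.symm).elim
  · intro k ih x hx x' hx' hd hd'
    rcases h _ (lt hd) x hx hd with ⟨e, -⟩ | ⟨k1, -, y, hy, hyd, e, rfl⟩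
    · simp at e
    · obtain rfl := add_right_cancel e
      rcases h' _ (lt hd') x' hx' hd' with ⟨e, -⟩ | ⟨k1, -, y', hy', hyd', e, rfl⟩
      · simp at e
      · obtain rfl := add_right_cancel e
        rw [ih y hy y' hy' hyd hyd']

variable (S) in
include hS in
-- The value at `k` is the one recorded in some finite justified history. Histories are extended one
-- pair at a time by `Σ⁰₁` induction, and two of them never disagree, so the graph is `Σ⁰₁`.
theorem exists_recursion {init : M → M} {G : M → M → M → M} (h0 : IsD1Fun S fun v => init (v 0))
    (h1 : IsD1Fun S fun v => G (v 0) (v 1) (v 2)) : ∃ R : M → M → M,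
      IsD1Fun S (fun v => R (v 0) (v 1)) ∧ (∀ a, R a 0 = init a) ∧
        ∀ a k, R a (k + 1) = G a k (R a k) := by
  have lt : ∀ {d k x : M}, DigitOne d (pair k x) → k < d ∧ x < d := fun hd =>
    ⟨(left_le_pair S _ _).trans_lt (hd.lt_self S), (right_le_pair S _ _).trans_lt (hd.lt_self S)⟩
  have step : ∀ a k y c, IsJustified init G a c → DigitOne c (pair k y) →
      ∃ c', IsJustified init G a c' ∧ DigitOne c' (pair (k + 1) (G a k y)) := by
    intro a k y c hc hd
    obtain ⟨c', hl, hc'⟩ := exists_code S (P := fun z => DigitOne c z ∨ z = pair (k + 1) (G a k y))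
      (.or (.digitOne (.const _) (.var _)) (.eq (.var _) (.const _)))
      (max c (pair (k + 1) (G a k y) + 1))
    have mono : ∀ {z}, DigitOne c z → DigitOne c' z := fun {z} hz =>
      (hc' z).2 ⟨lt_max_of_lt_left (hz.lt_self S), .inl hz⟩
    refine ⟨c', fun i _ x _ hix => ?_, (hc' _).2 ⟨lt_max_of_lt_right
      ((lt_add_one_iff' S _ _).2 le_rfl), .inr rfl⟩⟩
    rcases ((hc' _).1 hix).2 with hix | e
    · rcases hc i (lt hix).1 x (lt hix).2 hix with h | ⟨k', -, x', -, hd', e⟩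
      · exact .inl h
      · exact .inr ⟨k', (lt (mono hd')).1, x', (lt (mono hd')).2, mono hd', e⟩
    · obtain ⟨rfl, rfl⟩ := (pair_inj S).1 e
      exact .inr ⟨k, (lt (mono hd)).1, y, (lt (mono hd)).2, mono hd, rfl, rfl⟩
  have ex : ∀ a k, ∃ y c, IsJustified init G a c ∧ DigitOne c (pair k y) := by
    intro a
    refine IsSigma1.induct (S := S) (.ex (.ex (IsD1.and (.isJustified h0 h1 (.const _) (.var _))
      (.digitOne (.var _) (.pair (.var _) (.var _)))).1)) ?_ ?_
    · obtain ⟨c, hl, hc⟩ := exists_code S (P := fun z => z = pair 0 (init a))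
        (.eq (.var _) (.const _)) (pair 0 (init a) + 1)
      refine ⟨init a, c, fun i _ x _ hix => ?_, (hc _).2 ⟨(lt_add_one_iff' S _ _).2 le_rfl, rfl⟩⟩
      exact .inl ((pair_inj S).1 ((hc _).1 hix).2)
    · rintro k ⟨y, c, hc, hd⟩
      exact ⟨_, step a k y c hc hd⟩
  choose R c hc hd using ex
  have key : ∀ {a k y d}, IsJustified init G a d → DigitOne d (pair k y) → y = R a k :=
    fun {a k y d} hj hy => hj.unique S (hc a k) k y (lt hy).2 _ (lt (hd a k)).2 hy (hd a k)
  refine ⟨R, ?_, fun a => ?_, fun a k => ?_⟩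
  · refine IsSigma1.congr (P := fun w => ∃ d, IsJustified init G (w 1) d ∧
      DigitOne d (pair (w 2) (w 0))) (.ex (IsD1.and (.isJustified h0 h1 (.var _) (.var _))
        (.digitOne (.var _) (.pair (.var _) (.var _)))).1) fun w => ?_
    constructor
    · rintro ⟨d, hj, hy⟩
      exact key hj hy
    · intro e
      refine ⟨_, hc (w 1) (w 2), ?_⟩
      rw [e]
      exact hd _ _
  · rcases hc a 0 0 (lt (hd a 0)).1 _ (lt (hd a 0)).2 (hd a 0) with h | ⟨k', -, x', -, -, e, -⟩
    · exact h.2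
    · exact (hS.out.basic.succ_ne_zero _ e.symm).elim
  · obtain ⟨c', hc', hd'⟩ := step a k _ _ (hc a k) (hd a k)
    exact (key hc' hd').symm

/-! ### The pigeonhole principle -/

variable (S) in
include hS in
-- The induction on `B` changes the colouring, so the colouring must be a code under a universal
-- quantifier; this makes the statement `Π⁰₁`.
theorem pigeonhole_code : ∀ B c : M, (∀ i, i ≤ B → ∃ y, y < B ∧ DigitOne c (pair i y)) →
    ∃ j, j ≤ B ∧ ∃ i, i < j ∧ ∃ y, y < B ∧ DigitOne c (pair i y) ∧ DigitOne c (pair j y) := by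
  refine IsSigma1.induct_not (S := S) (.congr (P := fun v => ∃ c, ¬ ((∀ i, i ≤ v 0 → ∃ y, y < v 0 ∧
    DigitOne c (pair i y)) → ∃ j, j ≤ v 0 ∧ ∃ i, i < j ∧ ∃ y, y < v 0 ∧ DigitOne c (pair i y) ∧
      DigitOne c (pair j y))) (.ex (IsD1.not (.imp (.ballLe (.var _) (.bex (.var _)
        (.digitOne (.var _) (.pair (.var _) (.var _))))) (.bexLe (.var _) (.bex (.var _)
          (.bex (.var _) (.and (.digitOne (.var _) (.pair (.var _) (.var _)))
            (.digitOne (.var _) (.pair (.var _) (.var _))))))))).1) fun v => ?_) ?_ ?_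
  · rw [not_forall]
  · intro c h
    obtain ⟨y, hy, -⟩ := h 0 le_rfl
    exact (not_lt_zero hy).elim
  · intro B ih c h
    by_contra hn
    have inj : ∀ i j y, i < j → j ≤ B + 1 → y < B + 1 → DigitOne c (pair i y) →
        ¬ DigitOne c (pair j y) := fun i j y hi hj hy h1 h2 => hn ⟨j, hj, i, hi, y, hy, h1, h2⟩
    have hlt : ∀ {i}, i ≤ B → i < B + 1 := (lt_add_one_iff' S _ _).2
    -- A place of colour `B` is given instead the colours of the extra place `B + 1`. Any repetition
    -- in the new colouring comes from one in the old.
    obtain ⟨c', -, hc'⟩ := exists_code S (P := fun z => ∃ i, i ≤ B ∧ ∃ y, y < B ∧ z = pair i y ∧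
      (DigitOne c (pair i y) ∨ DigitOne c (pair i B) ∧ DigitOne c (pair (B + 1) y)))
      (.bexLe (.const _) (.bex (.const _) (.and (.eq (.var _) (.pair (.var _) (.var _)))
        (.or (.digitOne (.const _) (.pair (.var _) (.var _))) (.and
          (.digitOne (.const _) (.pair (.var _) (.const _)))
          (.digitOne (.const _) (.pair (.const _) (.var _)))))))) (pair B B + 1)
    have hc : ∀ {i y}, i ≤ B → y < B → (DigitOne c' (pair i y) ↔ (DigitOne c (pair i y) ∨
        DigitOne c (pair i B) ∧ DigitOne c (pair (B + 1) y))) := by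
      intro i y hi hy
      rw [hc', lt_add_one_iff' S, and_iff_right (pair_le_pair hi hy.le)]
      constructor
      · rintro ⟨i', -, y', -, e, h⟩
        obtain ⟨rfl, rfl⟩ := (pair_inj S).1 e
        exact h
      · exact fun h => ⟨i, hi, y, hy, rfl, h⟩
    obtain ⟨j, hj, i, hi, y, hy, h1, h2⟩ := ih c' fun i hi => by
      obtain ⟨y, hy, hd⟩ := h i (hlt hi).le
      rcases ((lt_add_one_iff' S _ _).1 hy).lt_or_eq with hyB | rfl
      · exact ⟨y, hyB, (hc hi hyB).2 (.inl hd)⟩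
      · obtain ⟨z, hz, hd'⟩ := h (y + 1) le_rfl
        have hzy : z < y := by
          refine lt_of_le_of_ne ((lt_add_one_iff' S _ _).1 hz) ?_
          rintro rfl
          exact inj i _ z (hlt hi) le_rfl hz hd hd'
        exact ⟨z, hzy, (hc hi hzy).2 (.inr ⟨hd, hd'⟩)⟩
    have hjB := hlt hj
    have hyB := hlt hy.le
    rcases (hc (hi.le.trans hj) hy).1 h1 with h1 | ⟨h1, h1'⟩ <;>
      rcases (hc hj hy).1 h2 with h2 | ⟨h2, h2'⟩
    · exact inj i j y hi hjB.le hyB h1 h2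
    · exact inj i _ y (hi.trans hjB) le_rfl hyB h1 h2'
    · exact inj j _ y hjB le_rfl hyB h2 h1'
    · exact inj i j B hi hjB.le (hlt le_rfl) h1 h2

variable (S) in
include hS in
theorem pigeonhole {R : M → M → Prop} (hR : IsD1 S (fun v => R (v 0) (v 1))) {B : M}
    (h : ∀ i, i ≤ B → ∃ y, y < B ∧ R i y) : ∃ j, j ≤ B ∧ ∃ i, i < j ∧ ∃ y, R i y ∧ R j y := by
  obtain ⟨c, -, hc⟩ := exists_code S (P := fun z => ∃ i, i ≤ B ∧ ∃ y, y < B ∧ z = pair i y ∧ R i y)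
    (.bexLe (.const _) (.bex (.const _) (.and (.eq (.var _) (.pair (.var _) (.var _)))
      (hR.comp₂ (.var _) (.var _))))) (pair B B + 1)
  have hcR : ∀ {i y}, DigitOne c (pair i y) → R i y := by
    intro i y hd
    obtain ⟨i', -, y', -, e, h⟩ := ((hc _).1 hd).2
    obtain ⟨rfl, rfl⟩ := (pair_inj S).1 e
    exact h
  obtain ⟨j, hj, i, hi, y, -, h1, h2⟩ := pigeonhole_code S B c fun i hi => by
    obtain ⟨y, hy, hR⟩ := h i hi
    exact ⟨y, hy, (hc _).2 ⟨(lt_add_one_iff' S _ _).2 (pair_le_pair hi hy.le), i, hi, y, hy,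
      rfl, hR⟩⟩
  exact ⟨j, hj, i, hi, y, hcR h1, hcR h2⟩

end Strings

/-! ### Combinatorics of return times, and continuous maps acting on strings -/

section Dynamics

variable {M : Type*} [CommSemiring M] [LinearOrder M] [IsStrictOrderedRing M]
  [CanonicallyOrderedAdd M] {S : Set (Set M)} [hS : Fact (ModelsRCA0 S)]

/-! ### Simultaneous returns -/

/-- The colours of `i` at the scale `r` are seen again between `i + r` and `i + V r`, and before
`q`. -/
def Returns (B V : M → M) (K : M → M → M → Prop) (r i q : M) : Prop :=
  ∃ j, j ≤ V r ∧ r ≤ j ∧ i + j < q ∧ ∃ y, y < B r ∧ K r i y ∧ K r (i + j) y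

theorem IsD1.returns {B V : M → M} {K : M → M → M → Prop} (hB : IsD1Fun S fun v => B (v 0))
    (hV : IsD1Fun S fun v => V (v 0)) (hK : IsD1 S fun v => K (v 0) (v 1) (v 2))
    {F G H : (ℕ → M) → M} (hF : IsD1Fun S F) (hG : IsD1Fun S G) (hH : IsD1Fun S H) :
    IsD1 S (fun v => Returns B V K (F v) (G v) (H v)) :=
  .comp₃ (P := Returns B V K) (.bexLe (hV.comp₁ (.var _)) (.and (.le (.var _) (.var _))
    (.and (.lt (.add (.var _) (.var _)) (.var _)) (.bex (hB.comp₁ (.var _))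
      (.and (hK.comp₃ (.var _) (.var _) (.var _))
        (hK.comp₃ (.var _) (.add (.var _) (.var _)) (.var _))))))) hF hG hH

include hS in
variable (S) in
-- `V (s + 1)` is the length of `B (s + 1) + 1` blocks of length `V s`, each followed by a gap of
-- length `s + 1`. Pigeonhole on the good points of the blocks gives a return at the new scale,
-- while the earlier point keeps its old returns inside its own block.
theorem exists_returns {B V : M → M} {K : M → M → M → Prop} (hB : IsD1Fun S fun v => B (v 0))
    (hV : IsD1Fun S fun v => V (v 0)) (hK : IsD1 S fun v => K (v 0) (v 1) (v 2)) (V_zero : V 0 = 1)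
    (V_succ : ∀ s, V (s + 1) = (B (s + 1) + 1) * (V s + (s + 1))) {L : M}
    (h : ∀ s, s ≤ L → ∀ i, i < V L → ∃ y, y < B s ∧ K s i y) :
    ∃ i, i < V L ∧ ∀ r, r ≤ L → Returns B V K r i (V L) := by
  -- The claim is made for every interval of length `V s` within the horizon, with the returns
  -- confined to the interval, so that it can be used in each block. All quantifiers are bounded, so
  -- `Δ⁰₁` induction suffices.
  have main : ∀ s, s ≤ L → ∀ p, p ≤ V L → p + V s ≤ V L → ∃ i, i < p + V s ∧ p ≤ i ∧
      ∀ r, r ≤ s → Returns B V K r i (p + V s) := by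
    refine IsD1.induct (S := S) (.imp (.le (.var _) (.const _)) (.ballLe (.const _) (.imp
      (.le (.add (.var _) (hV.comp₁ (.var _))) (.const _)) (.bex
        (.add (.var _) (hV.comp₁ (.var _))) (.and (.le (.var _) (.var _)) (.ballLe (.var _)
          (.returns hB hV hK (.var _) (.var _) (.add (.var _) (hV.comp₁ (.var _)))))))))) ?_ ?_
    · intro _ p _ hp
      have hlt : p < p + V 0 := by
        rw [V_zero]
        exact (lt_add_one_iff' S _ _).2 le_rfl
      refine ⟨p, hlt, le_rfl, fun r hr => ?_⟩
      obtain rfl := nonpos_iff_eq_zero.1 hr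
      obtain ⟨y, hy, hK⟩ := h 0 zero_le p (hlt.trans_le hp)
      exact ⟨0, zero_le, le_rfl, by rwa [add_zero], y, hy, hK, by rwa [add_zero]⟩
    · intro s ih hs p _ hp
      have hsL : s ≤ L := le_self_add.trans hs
      have hblock : ∀ b, b ≤ B (s + 1) →
          p + b * (V s + (s + 1)) + V s ≤ p + V (s + 1) := by
        intro b hb
        rw [V_succ, add_assoc]
        gcongr
        calc b * (V s + (s + 1)) + V s ≤ b * (V s + (s + 1)) + (V s + (s + 1)) := by
              gcongr
              exact le_self_add
          _ = (b + 1) * (V s + (s + 1)) := by ring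
          _ ≤ _ := by gcongr
      obtain ⟨b₂, hb₂, b₁, hb, y, ⟨hy, i₁, hi₁, hi₁', hr₁, hK₁⟩, -, i₂, hi₂, hi₂', -, hK₂⟩ :=
        pigeonhole S (R := fun b y => y < B (s + 1) ∧ ∃ i, i < p + b * (V s + (s + 1)) + V s ∧
          p + b * (V s + (s + 1)) ≤ i ∧
          (∀ r, r ≤ s → Returns B V K r i (p + b * (V s + (s + 1)) + V s)) ∧ K (s + 1) i y)
          (.and (.lt (.var _) (.const _)) (.bex
            (.add (.add (.const _) (.mul (.var _) (.const _))) (.const _)) (.and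
            (.le (.add (.const _) (.mul (.var _) (.const _))) (.var _)) (.and (.ballLe (.const _)
            (.returns hB hV hK (.var _) (.var _) (.add (.add (.const _)
              (.mul (.var _) (.const _))) (.const _)))) (hK.comp₃ (.const _) (.var _) (.var _))))))
          (B := B (s + 1)) fun b hb => by
            have hle := (hblock b hb).trans hp
            obtain ⟨i, hi, hpi, hr⟩ := ih hsL _ (le_self_add.trans hle) hle
            obtain ⟨y, hy, hK⟩ := h (s + 1) hs i (hi.trans_le hle)
            exact ⟨y, hy, hy, i, hi, hpi, hr, hK⟩
      have hb₁ := hblock b₁ (hb.le.trans hb₂)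
      refine ⟨i₁, hi₁.trans_le hb₁, le_self_add.trans hi₁', fun r hr => ?_⟩
      rcases hr.lt_or_eq with hr | rfl
      · obtain ⟨j, hj, hrj, hij, hy⟩ := hr₁ r ((lt_add_one_iff' S _ _).1 hr)
        exact ⟨j, hj, hrj, hij.trans_le hb₁, hy⟩
      -- The gap between blocks makes the return time at least `s + 1`; both points lie in one
      -- interval of length `V (s + 1)`, which bounds it above.
      · have hgap : i₁ + (s + 1) ≤ i₂ := by
          refine le_trans ?_ hi₂'
          calc i₁ + (s + 1) ≤ p + b₁ * (V s + (s + 1)) + V s + (s + 1) := by gcongr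
            _ = p + (b₁ + 1) * (V s + (s + 1)) := by ring
            _ ≤ _ := by
              gcongr
              exact (add_one_le_iff' S _ _).2 hb
        obtain ⟨d, rfl⟩ := exists_add_of_le hgap
        have hlt := hi₂.trans_le (hblock b₂ hb₂)
        rw [add_assoc] at hlt hK₂
        refine ⟨s + 1 + d, ?_, le_self_add, hlt, y, hy, hK₁, hK₂⟩
        have hp₁ : p ≤ i₁ := le_self_add.trans hi₁'
        exact le_of_add_le_add_left ((add_le_add_left hp₁ _).trans hlt.le)
  obtain ⟨i, hi, -, hr⟩ := main L le_rfl 0 zero_le (by rw [zero_add])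
  rw [zero_add] at hi hr
  exact ⟨i, hi, hr⟩

/-! ### Strings and their lengths -/

open Classical in
/-- The length of the string described by `x`. -/
noncomputable def len (x : M) : M := if h : ∃ l, HasLength x l then h.choose else 0

include hS in
variable (S) in
theorem HasLength.len_eq {x l : M} (h : HasLength x l) : len x = l := by
  have h' : ∃ l, HasLength x l := ⟨l, h⟩
  rw [len, dif_pos h']
  exact h'.choose_spec.unique S h

include hS in
variable (S) in
theorem IsString.hasLength {x : M} (h : IsString x) : HasLength x (len x) := by
  obtain ⟨l, hl⟩ := h.1
  rwa [hl.len_eq S]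

theorem IsD1Fun.len {F : (ℕ → M) → M} (hF : IsD1Fun S F) : IsD1Fun S (fun v => len (F v)) := by
  refine .comp₁ (H := SecondOrderArithmetic.len) (.of_isD1 (.congr (P := fun w =>
    HasLength (w 1) (w 0) ∨ (¬ ∃ l, l ≤ w 1 ∧ HasLength (w 1) l) ∧ w 0 = 0) (.or
    (.hasLength (.var _) (.var _)) (.and (.not (.bexLe (.var _) (.hasLength (.var _) (.var _))))
      (.eq (.var _) (.const _)))) fun w => ?_)) hF
  by_cases h : ∃ l, HasLength (w 1) l
  · obtain ⟨l, hl⟩ := h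
    change _ ↔ w 0 = SecondOrderArithmetic.len (w 1)
    rw [hl.len_eq S]
    constructor
    · rintro (h | ⟨h, -⟩)
      · exact h.unique S hl
      · exact (h ⟨l, hl.le S, hl⟩).elim
    · rintro rfl
      exact .inl hl
  · change _ ↔ w 0 = SecondOrderArithmetic.len (w 1)
    rw [SecondOrderArithmetic.len, dif_neg h]
    exact ⟨fun h' => h'.elim (fun h' => (h ⟨_, h'⟩).elim) And.right,
      fun h' => .inr ⟨fun ⟨l, _, hl⟩ => h ⟨l, hl⟩, h'⟩⟩

/-- The string `σ` is an initial segment of `τ`, in terms of lengths. -/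
def IsInitial (σ τ : M) : Prop :=
  len σ ≤ len τ ∧ ∀ i, i < len σ → (DigitOne σ i ↔ DigitOne τ i)

theorem IsD1.isInitial {F G : (ℕ → M) → M} (hF : IsD1Fun S F) (hG : IsD1Fun S G) :
    IsD1 S (fun v => IsInitial (F v) (G v)) :=
  .comp₂ (P := IsInitial) (.and (.le (.len (.var _)) (.len (.var _))) (.ball (.len (.var _))
    (.iff (.digitOne (.var _) (.var _)) (.digitOne (.var _) (.var _))))) hF hG

include hS in
variable (S) in
theorem isPrefix_iff {σ τ : M} (hσ : IsString σ) (hτ : IsString τ) :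
    IsPrefix σ τ ↔ IsInitial σ τ := by
  constructor
  · rintro ⟨l, l', h, h', hl, hd⟩
    rw [IsInitial, h.len_eq S, h'.len_eq S]
    exact ⟨le_iff_lt_or_eq.2 hl, hd⟩
  · rintro ⟨hl, hd⟩
    exact ⟨_, _, hσ.hasLength S, hτ.hasLength S, le_iff_lt_or_eq.1 hl, hd⟩

include hS in
variable (S) in
theorem exists_isInitial {τ l : M} (hl : l ≤ len τ) :
    ∃ σ, IsString σ ∧ len σ = l ∧ IsInitial σ τ := by
  obtain ⟨σ, hσ, hσl, hd⟩ := exists_isString S (P := DigitOne τ) (.digitOne (.const _) (.var _)) l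
  have e := hσl.len_eq S
  exact ⟨σ, hσ, e, e.trans_le hl, fun i hi => hd i (hi.trans_eq e)⟩

/-- `σ` is an initial segment of `X`. -/
def IsSegment (X : Set M) (σ : M) : Prop := IsString σ ∧ ∀ i, i < len σ → (DigitOne σ i ↔ i ∈ X)

include hS in
variable (S) in
theorem isRestriction_iff {σ l : M} {X : Set M} :
    IsRestriction σ X l ↔ IsSegment X σ ∧ len σ = l := by
  constructor
  · rintro ⟨h, hl, hd⟩
    obtain rfl := hl.len_eq S
    exact ⟨⟨h, hd⟩, rfl⟩
  · rintro ⟨⟨h, hd⟩, rfl⟩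
    exact ⟨h, h.hasLength S, hd⟩

theorem IsD1.isSegment {X : Set M} (hX : X ∈ S) {F : (ℕ → M) → M} (hF : IsD1Fun S F) :
    IsD1 S (fun v => IsSegment X (F v)) :=
  .comp₁ (P := IsSegment X) (.and (.isString (.var _)) (.ball (.len (.var _))
    (.iff (.digitOne (.var _) (.var _)) (.mem hX (.var _))))) hF

theorem IsSegment.isInitial {X : Set M} {σ τ : M} (hσ : IsSegment X σ) (hτ : IsSegment X τ)
    (h : len σ ≤ len τ) : IsInitial σ τ :=
  ⟨h, fun i hi => (hσ.2 i hi).trans (hτ.2 i (hi.trans_le h)).symm⟩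

variable (S) in
include hS in
theorem exists_isSegment {X : Set M} (hX : X ∈ S) (l : M) : ∃ σ, IsSegment X σ ∧ len σ = l := by
  obtain ⟨σ, hσ, hl, hd⟩ := exists_isString S (P := fun i => i ∈ X) (.mem hX (.var _)) l
  obtain rfl := hl.len_eq S
  exact ⟨σ, ⟨hσ, hd⟩, rfl⟩

/-! ### Iteration of continuous transformations -/

/-- `F` is a `Δ⁰₁` continuous transformation of strings. -/
structure IsStringMap (S : Set (Set M)) (F : M → M) : Prop where
  isD1Fun : IsD1Fun S fun v => F (v 0)
  isString : ∀ {σ}, IsString σ → IsString (F σ)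
  mono : ∀ {σ τ}, IsString σ → IsString τ → IsInitial σ τ → IsInitial (F σ) (F τ)
  length : ∀ l, ∃ m, ∀ σ, IsString σ → len σ = m → l ≤ len (F σ)

theorem EncodesTransformation.exists_isStringMap {f : Set M} (h : EncodesTransformation f)
    (hf : f ∈ S) : ∃ F, IsStringMap S F ∧
      ∀ σ τ, IsString σ → (pair σ τ ∈ f ↔ τ = F σ) := by
  obtain ⟨F, hF, hFf⟩ := IsD1.exists_choice (S := S) (P := fun x y => IsString x → pair x y ∈ f)
    (.imp (.isString (.var _)) (.mem hf (.pair (.var _) (.var _)))) fun x => by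
      by_cases hx : IsString x
      · obtain ⟨y, hy, -⟩ := h.total.2 x hx
        exact ⟨y, fun _ => hy⟩
      -- Off the strings nothing is required of the value, and `0` is a default.
      · exact ⟨0, fun hx' => (hx hx').elim⟩
  have hstr : ∀ {σ}, IsString σ → IsString (F σ) := by
    intro σ hσ
    obtain ⟨x, y, -, hy, e⟩ := h.total.1 _ (hFf σ hσ)
    rwa [((pair_inj S).1 e).2]
  refine ⟨F, ⟨hF, hstr, fun {σ τ} hσ hτ hi => ?_, fun l => ?_⟩, fun σ τ hσ => ⟨fun hτ => ?_, ?_⟩⟩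
  · exact (isPrefix_iff S (hstr hσ) (hstr hτ)).1
      (h.order σ τ _ _ (hFf σ hσ) (hFf τ hτ) ((isPrefix_iff S hσ hτ).2 hi))
  · obtain ⟨m, hm⟩ := h.length l
    refine ⟨m, fun σ hσ hl => ?_⟩
    obtain ⟨l', hl', hle⟩ := hm σ _ (hl ▸ hσ.hasLength S) (hFf σ hσ)
    rw [hl'.len_eq S]
    exact le_iff_lt_or_eq.2 hle
  · exact (h.total.2 σ hσ).unique hτ (hFf σ hσ)
  · rintro rfl
    exact hFf σ hσ

/-- `it σ k` is the `k`-th iterate of `F` at `σ`. -/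
structure IsIterate (S : Set (Set M)) (F : M → M) (it : M → M → M) : Prop where
  isD1Fun : IsD1Fun S fun v => it (v 0) (v 1)
  zero : ∀ σ, it σ 0 = σ
  succ : ∀ σ k, it σ (k + 1) = F (it σ k)

namespace IsIterate

variable {F : M → M} {it : M → M → M}

theorem add (h : IsIterate S F it) (σ i : M) : ∀ j, it σ (i + j) = it (it σ i) j := by
  refine IsD1.induct (S := S) (.eq (h.isD1Fun.comp₂ (.const _) (.add (.const _) (.var _)))
    (h.isD1Fun.comp₂ (.const _) (.var _))) ?_ fun j ih => ?_
  · rw [add_zero, h.zero]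
  · rw [← add_assoc, h.succ, ih, h.succ]

theorem succ' (h : IsIterate S F it) (σ k : M) : it σ (k + 1) = it (F σ) k := by
  have e := h.succ σ 0
  rw [zero_add, h.zero] at e
  rw [add_comm, h.add, e]

theorem isString (h : IsIterate S F it) (hF : IsStringMap S F) {σ : M} (hσ : IsString σ) :
    ∀ k, IsString (it σ k) := by
  refine IsD1.induct (S := S) (.isString (h.isD1Fun.comp₂ (.const _) (.var _))) ?_ fun k ih => ?_
  · rwa [h.zero]
  · rw [h.succ]
    exact hF.isString ih

theorem mono (h : IsIterate S F it) (hF : IsStringMap S F) {σ τ : M} (hσ : IsString σ)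
    (hτ : IsString τ) (hi : IsInitial σ τ) : ∀ k, IsInitial (it σ k) (it τ k) := by
  refine IsD1.induct (S := S) (.isInitial (h.isD1Fun.comp₂ (.const _) (.var _))
    (h.isD1Fun.comp₂ (.const _) (.var _))) ?_ fun k ih => ?_
  · rwa [h.zero, h.zero]
  · rw [h.succ, h.succ]
    exact hF.mono (h.isString hF hσ k) (h.isString hF hτ k) ih

theorem mem (h : IsIterate S F it) {C : Set M} (hC : C ∈ S) (hCF : ∀ σ ∈ C, F σ ∈ C) {σ : M}
    (hσ : σ ∈ C) : ∀ k, it σ k ∈ C := by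
  refine IsD1.induct (S := S) (.mem hC (h.isD1Fun.comp₂ (.const _) (.var _))) ?_ fun k ih => ?_
  · rwa [h.zero]
  · rw [h.succ]
    exact hCF _ ih

end IsIterate

theorem IsStringMap.exists_isIterate {F : M → M} (hF : IsStringMap S F) :
    ∃ it, IsIterate S F it := by
  obtain ⟨it, h, h0, h1⟩ := exists_recursion S (init := fun a => a) (G := fun _ _ x => F x) (.var _)
    (hF.isD1Fun.comp₁ (.var _))
  exact ⟨it, h, h0, h1⟩

/-- The strings of a given length have bounded codes, so being a modulus is `Δ⁰₁` and least moduli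
can be chosen; monotonicity extends the estimate to longer strings. -/
theorem IsStringMap.exists_modulus {F : M → M} (hF : IsStringMap S F) :
    ∃ m : M → M, IsD1Fun S (fun v => m (v 0)) ∧
      ∀ l σ, IsString σ → m l ≤ len σ → l ≤ len (F σ) := by
  obtain ⟨B, hB, hσB⟩ := exists_string_bound S
  obtain ⟨m, hm, h⟩ := IsD1.exists_choice (S := S) (P := fun l m => ∀ σ, σ < B m → IsString σ →
    len σ = m → l ≤ len (F σ)) (.ball (hB.comp₁ (.var _)) (.imp (.isString (.var _))
      (.imp (.eq (.len (.var _)) (.var _)) (.le (.var _) (.len (hF.isD1Fun.comp₁ (.var _)))))))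
    fun l => (hF.length l).imp fun m h σ _ => h σ
  refine ⟨m, hm, fun l σ hσ hl => ?_⟩
  obtain ⟨ρ, hρ, hρl, hi⟩ := exists_isInitial S hl
  exact (h l ρ (hσB _ _ hρ (hρl ▸ hρ.hasLength S)) hρ hρl).trans (hF.mono hρ hσ hi).1

/-- The iterates up to `J` of long strings are long. -/
theorem IsIterate.exists_length {F : M → M} {it : M → M → M} (h : IsIterate S F it)
    (hF : IsStringMap S F) (l J : M) :
    ∃ m, ∀ σ, IsString σ → m ≤ len σ → ∀ j, j ≤ J → l ≤ len (it σ j) := by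
  obtain ⟨μ, hμ, hμF⟩ := hF.exists_modulus
  -- Adding `x` to `μ x` makes the iterated modulus nondecreasing in `j`, so that its value at `J`
  -- serves all `j ≤ J`.
  obtain ⟨R, hR, hR0, hR1⟩ := exists_recursion S (init := fun a => a) (G := fun _ _ x => x + μ x)
    (.var _) (.add (.var _) (hμ.comp₁ (.var _)))
  -- The statement is `Π⁰₁`, as the step applies the hypothesis at `j` to `F σ` in place of `σ`.
  have hlen : ∀ j, ∀ σ, IsString σ → R l j ≤ len σ → l ≤ len (it σ j) := by
    refine IsSigma1.induct_not (S := S) (.congr (P := fun v => ∃ σ, ¬ (IsString σ →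
      R l (v 0) ≤ len σ → l ≤ len (it σ (v 0)))) (.ex (IsD1.not (.imp (.isString (.var _)) (.imp
        (.le (hR.comp₂ (.const _) (.var _)) (.len (.var _)))
        (.le (.const _) (.len (h.isD1Fun.comp₂ (.var _) (.var _))))))).1)
      fun v => by rw [not_forall]) ?_ ?_
    · intro σ hσ hl
      rwa [h.zero, ← hR0 l]
    · intro j ih σ hσ hl
      rw [h.succ']
      rw [hR1] at hl
      exact ih _ (hF.isString hσ) (hμF _ σ hσ (le_add_self.trans hl))
  have hmono : ∀ J, ∀ j, j ≤ J → R l j ≤ R l J := by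
    refine IsD1.induct (S := S) (.ballLe (.var _) (.le (hR.comp₂ (.const _) (.var _))
      (hR.comp₂ (.const _) (.var _)))) ?_ ?_
    · intro j hj
      rw [nonpos_iff_eq_zero.1 hj]
    · intro J ih j hj
      rcases hj.lt_or_eq with hj | rfl
      · rw [hR1]
        exact (ih j ((lt_add_one_iff' S _ _).1 hj)).trans le_self_add
      · exact le_rfl
  exact ⟨R l J, fun σ hσ hl j hj => hlen j σ hσ ((hmono J j hj).trans hl)⟩

end Dynamics

/-! ### Weak König's lemma applied to the tree of bounded return times -/

section Recurrence

variable {M : Type*} [CommSemiring M] [LinearOrder M] [IsStrictOrderedRing M]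
  [CanonicallyOrderedAdd M] {S : Set (Set M)} [hS : Fact (ModelsRCA0 S)]

/-! ### The tree of strings with bounded return times -/

/-- The strings of `C` for which, at every scale `s`, a return between the times `s` and `V s` is
not excluded. -/
def returnTree (C : Set M) (it : M → M → M) (V : M → M) : Set M :=
  {τ | τ ∈ C ∧ ∀ s, s ≤ len τ → ∃ j, j ≤ V s ∧ s ≤ j ∧
    ∀ i, i < s → i < len (it τ j) → (DigitOne (it τ j) i ↔ DigitOne τ i)}

variable {C : Set M} {F : M → M} {it : M → M → M} {V : M → M}

theorem returnTree_mem (hC : C ∈ S) (h : IsIterate S F it) (hV : IsD1Fun S fun v => V (v 0)) :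
    returnTree C it V ∈ S :=
  IsD1.mem_of (P := fun τ => τ ∈ C ∧ ∀ s, s ≤ len τ → ∃ j, j ≤ V s ∧ s ≤ j ∧
    ∀ i, i < s → i < len (it τ j) → (DigitOne (it τ j) i ↔ DigitOne τ i))
    (.and (.mem hC (.var _)) (.ballLe (.len (.var _)) (.bexLe (hV.comp₁ (.var _))
      (.and (.le (.var _) (.var _)) (.ball (.var _) (.imp
        (.lt (.var _) (.len (h.isD1Fun.comp₂ (.var _) (.var _))))
        (.iff (.digitOne (h.isD1Fun.comp₂ (.var _) (.var _)) (.var _))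
          (.digitOne (.var _) (.var _)))))))))

include hS in
variable (S) in
theorem IsTree.mem_of_isInitial (hC : IsTree C) {σ τ : M} (hσ : IsString σ) (hτ : τ ∈ C)
    (hi : IsInitial σ τ) : σ ∈ C :=
  hC.2 τ hτ σ hσ ((isPrefix_iff S hσ (hC.1 τ hτ)).2 hi)

/-- An initial segment has fewer scales to satisfy, and by monotonicity its iterates determine fewer
digits, so every return that serves the longer string serves it too. -/
theorem isTree_returnTree (hC : IsTree C) (hF : IsStringMap S F) (h : IsIterate S F it) :
    IsTree (returnTree C it V) := by
  refine ⟨fun σ hσ => hC.1 σ hσ.1, fun τ hτ σ hσ hp => ⟨hC.2 τ hτ.1 σ hσ hp, fun s hs => ?_⟩⟩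
  have hi := (isPrefix_iff S hσ (hC.1 τ hτ.1)).1 hp
  obtain ⟨j, hj, hsj, hd⟩ := hτ.2 s (hs.trans hi.1)
  have hij := h.mono hF hσ (hC.1 τ hτ.1) hi j
  refine ⟨j, hj, hsj, fun i his hl => ?_⟩
  rw [hij.2 i hl, hi.2 i (his.trans_le hs)]
  exact hd i his (hl.trans_le hij.1)

/-- If `C` has a path and is invariant, the tree has strings of all lengths. -/
theorem exists_mem_returnTree (hCS : C ∈ S) (hC : IsTree C) (hF : IsStringMap S F)
    (h : IsIterate S F it) (hCF : ∀ σ ∈ C, F σ ∈ C) {X : Set M} (hXC : IsPath C X)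
    {B : M → M} (hB : IsD1Fun S fun v => B (v 0))
    (hBσ : ∀ l σ, IsString σ → HasLength σ l → σ < B l) (hV : IsD1Fun S fun v => V (v 0))
    (V_zero : V 0 = 1) (V_succ : ∀ s, V (s + 1) = (B (s + 1) + 1) * (V s + (s + 1))) (L : M) :
    ∃ τ ∈ returnTree C it V, len τ = L := by
  -- The path through `C` is needed only for one string, long enough that its iterates up to `V L`
  -- all have length at least `L`.
  obtain ⟨m, hm⟩ := h.exists_length hF L (V L)
  obtain ⟨σ, hσC, hσX⟩ := hXC m
  obtain ⟨⟨hσ, -⟩, rfl⟩ := (isRestriction_iff S).1 hσX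
  have hlen : ∀ i, i ≤ V L → L ≤ len (it σ i) := hm σ hσ le_rfl
  -- The colour of `i` at scale `s` is the initial segment of length `s` of the `i`-th iterate of
  -- `σ`.
  obtain ⟨i, hi, hr⟩ := exists_returns S hB hV (K := fun s i y => IsString y ∧ len y = s ∧
    IsInitial y (it σ i)) (.and (.isString (.var _)) (.and (.eq (.len (.var _)) (.var _))
      (.isInitial (.var _) (h.isD1Fun.comp₂ (.const _) (.var _))))) V_zero V_succ (L := L)
    fun s hs i hi => by
      obtain ⟨y, hy, e, hyi⟩ := exists_isInitial S (hs.trans (hlen i hi.le))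
      exact ⟨y, hBσ s y hy (e ▸ hy.hasLength S), hy, e, hyi⟩
  -- At the good time `i` the first `L` digits are kept. The iterates of `τ` are initial segments of
  -- later iterates of `σ`, so the returns pass to `τ` wherever digits are determined.
  obtain ⟨τ, hτ, rfl, hτi⟩ := exists_isInitial S (hlen i hi.le)
  refine ⟨τ, ⟨hC.mem_of_isInitial S hτ (h.mem hCS hCF hσC i) hτi, fun s hs => ?_⟩, rfl⟩
  obtain ⟨j, hj, hsj, hij, y, -, ⟨-, rfl, hy⟩, -, -, hy'⟩ := hr s hs
  refine ⟨j, hj, hsj, fun k hk hkl => ?_⟩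
  rw [(h.mono hF hτ (h.isString hF hσ i) hτi j).2 k hkl, hτi.2 k (hk.trans_le hs), ← h.add,
    ← hy'.2 k hk, hy.2 k hk]

/-! ### Images of points under iterates -/

/-- A digit of `Y` can be read off the image of any sufficiently long segment of `X`. The images
agree with each other, so both membership and non-membership are `Σ⁰₁`. -/
theorem IsIterate.exists_image (hF : IsStringMap S F) (h : IsIterate S F it) {X : Set M}
    (hX : X ∈ S) (k : M) : ∃ Y ∈ S, (∀ σ, IsSegment X σ → IsSegment Y (it σ k)) ∧
      ∀ l, ∃ σ, IsSegment X σ ∧ l ≤ len (it σ k) := by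
  have hlen : ∀ l, ∃ σ, IsSegment X σ ∧ l ≤ len (it σ k) := fun l => by
    obtain ⟨m, hm⟩ := h.exists_length hF l k
    obtain ⟨σ, hσ, rfl⟩ := exists_isSegment S hX m
    exact ⟨σ, hσ, hm σ hσ.1 le_rfl k le_rfl⟩
  have hcoh : ∀ {σ τ i}, IsSegment X σ → IsSegment X τ → i < len (it σ k) → i < len (it τ k) →
      (DigitOne (it σ k) i ↔ DigitOne (it τ k) i) := by
    intro σ τ i hσ hτ hi hi'
    rcases le_total (len σ) (len τ) with hl | hl
    · exact (h.mono hF hσ.1 hτ.1 (hσ.isInitial hτ hl) k).2 i hi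
    · exact ((h.mono hF hτ.1 hσ.1 (hτ.isInitial hσ hl) k).2 i hi').symm
  have hit : ∀ {n : ℕ}, IsD1Fun S fun v => it (v n) k := h.isD1Fun.comp₂ (.var _) (.const _)
  have hY : {i | ∃ σ, (IsSegment X σ ∧ i < len (it σ k)) ∧ DigitOne (it σ k) i} ∈ S := by
    refine IsD1.mem_of (P := fun i => ∃ σ, (IsSegment X σ ∧ i < len (it σ k)) ∧
      DigitOne (it σ k) i) ⟨.ex (IsD1.and (.and (.isSegment hX (.var _))
        (.lt (.var _) (.len hit))) (.digitOne hit (.var _))).1, IsSigma1.congr (P := fun v => ∃ σ,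
          (IsSegment X σ ∧ v 0 < len (it σ k)) ∧ ¬ DigitOne (it σ k) (v 0))
      (.ex (IsD1.and (.and (.isSegment hX (.var _)) (.lt (.var _) (.len hit)))
        (.not (.digitOne hit (.var _)))).1) fun v => ?_⟩
    constructor
    · rintro ⟨σ, ⟨hσ, hi⟩, hd⟩ ⟨τ, ⟨hτ, hi'⟩, hd'⟩
      exact hd ((hcoh hσ hτ hi hi').2 hd')
    · intro hn
      obtain ⟨σ, hσ, hl⟩ := hlen (v 0 + 1)
      have hi := (add_one_le_iff' S _ _).1 hl
      exact ⟨σ, ⟨hσ, hi⟩, fun hd => hn ⟨σ, ⟨hσ, hi⟩, hd⟩⟩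
  refine ⟨_, hY, fun σ hσ => ⟨h.isString hF hσ.1 k, fun i hi => ?_⟩, hlen⟩
  exact ⟨fun hd => ⟨σ, ⟨hσ, hi⟩, hd⟩, fun ⟨τ, ⟨hτ, hi'⟩, hd⟩ => (hcoh hσ hτ hi hi').2 hd⟩

/-- Points on paths through the tree return at all scales. -/
theorem exists_return (hF : IsStringMap S F) (h : IsIterate S F it) {X : Set M}
    (hXT : IsPath (returnTree C it V) X) (s : M) :
    ∃ j, s ≤ j ∧ ∀ Y : Set M, (∀ σ, IsSegment X σ → IsSegment Y (it σ j)) →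
      ∀ i, i < s → (i ∈ Y ↔ i ∈ X) := by
  -- Beyond this length every iterate up to `V s` determines `s` digits, so the condition defining
  -- the tree has no undetermined digits left to exempt.
  obtain ⟨m, hm⟩ := h.exists_length hF s (V s)
  obtain ⟨σ, hσT, hσ⟩ := hXT (max m s)
  obtain ⟨hσ, hl⟩ := (isRestriction_iff S).1 hσ
  have hs : s ≤ len σ := hl ▸ le_max_right _ _
  obtain ⟨j, hj, hsj, hd⟩ := hσT.2 s hs
  refine ⟨j, hsj, fun Y hY i hi => ?_⟩
  have hij := hi.trans_le (hm σ hσ.1 (hl ▸ le_max_left _ _) j hj)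
  rw [← (hY σ hσ).2 i hij, hd i hi hij, hσ.2 i (hi.trans_le hs)]

theorem IsIterate.isIteration {f : Set M} (hF : IsStringMap S F) (h : IsIterate S F it)
    (hf : ∀ σ τ, IsString σ → (pair σ τ ∈ f ↔ τ = F σ)) :
    ∃ g ∈ S, IsIteration f g ∧
      ∀ σ k τ, IsString σ → (pair (pair σ k) τ ∈ g ↔ τ = it σ k) := by
  let P : M → Prop := fun z => ∃ σ, σ ≤ z ∧ ∃ k, k ≤ z ∧ IsString σ ∧
    z = pair (pair σ k) (it σ k)
  have hP : IsD1 S fun v => P (v 0) := .bexLe (.var _) (.bexLe (.var _) (.and (.isString (.var _))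
    (.eq (.var _) (.pair (.pair (.var _) (.var _)) (h.isD1Fun.comp₂ (.var _) (.var _))))))
  have key : ∀ σ k τ, P (pair (pair σ k) τ) ↔ IsString σ ∧ τ = it σ k := by
    intro σ k τ
    constructor
    · rintro ⟨σ', -, k', -, hσ, e⟩
      obtain ⟨e', rfl⟩ := (pair_inj S).1 e
      obtain ⟨rfl, rfl⟩ := (pair_inj S).1 e'
      exact ⟨hσ, rfl⟩
    · rintro ⟨hσ, rfl⟩
      exact ⟨σ, (left_le_pair S _ _).trans (left_le_pair S _ _), k,
        (right_le_pair S _ _).trans (left_le_pair S _ _), hσ, rfl⟩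
  refine ⟨{z | P z}, hP.mem_of, ⟨⟨?_, ?_⟩, ?_, ?_⟩, fun σ k τ hσ =>
    (key σ k τ).trans (and_iff_right hσ)⟩
  · rintro z ⟨σ, -, k, -, hσ, rfl⟩
    exact ⟨_, _, ⟨σ, k, hσ, rfl⟩, h.isString hF hσ k, rfl⟩
  · rintro z ⟨σ, k, hσ, rfl⟩
    exact ⟨it σ k, (key _ _ _).2 ⟨hσ, rfl⟩, fun τ hτ => ((key _ _ _).1 hτ).2⟩
  · exact fun σ hσ => (key _ _ _).2 ⟨hσ, (h.zero σ).symm⟩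
  · intro σ k τ ρ hτ hρ
    obtain ⟨hσ, rfl⟩ := (key _ _ _).1 hτ
    refine (key _ _ _).2 ⟨hσ, ?_⟩
    rw [h.succ]
    exact (hf _ _ (h.isString hF hσ k)).1 hρ

variable (S) in
include hS in
theorem WKL.recurrence (hW : WKL S) : RP S := by
  intro C f hsys
  obtain ⟨F, hF, hFf⟩ := hsys.transformation.exists_isStringMap hsys.f_mem
  obtain ⟨it, h⟩ := hF.exists_isIterate
  obtain ⟨B, hB, hBσ⟩ := exists_string_bound S
  -- The parameter of the recursion is a dummy; `R 0` is the function `V` of return bounds.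
  obtain ⟨R, hR, hR0, hR1⟩ := exists_recursion S (init := fun _ => 1)
    (G := fun _ s x => (B (s + 1) + 1) * (x + (s + 1))) (.const _)
    (.mul (.add (hB.comp₁ (.add (.var _) (.const _))) (.const _))
      (.add (.var _) (.add (.var _) (.const _))))
  have hV : IsD1Fun S fun v => R 0 (v 0) := hR.comp₂ (.const _) (.var _)
  have hCF : ∀ σ ∈ C, F σ ∈ C := fun σ hσ =>
    hsys.invariant σ hσ _ ((hFf σ _ (hsys.tree.1 σ hσ)).2 rfl)
  obtain ⟨Z, -, hZC⟩ := hsys.nonempty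
  obtain ⟨X, hX, hXT⟩ := hW _ (returnTree_mem (V := R 0) hsys.C_mem h hV)
    (isTree_returnTree hsys.tree hF h) fun k => by
      obtain ⟨τ, hτ, hl⟩ := exists_mem_returnTree hsys.C_mem hsys.tree hF h hCF hZC hB hBσ hV
        (hR0 0) (hR1 0) (k + 1)
      -- A code is at least the length of its string, so a string of length `k + 1` has code above
      -- `k`.
      refine ⟨τ, hτ, (add_one_le_iff' S _ _).1 ?_⟩
      rw [← hl]
      exact ((hsys.tree.1 τ hτ.1).hasLength S).le S
  obtain ⟨g, hg, hfg, hgit⟩ := h.isIteration hF hFf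
  refine ⟨X, hX, fun l => (hXT l).imp fun σ hσ => ⟨hσ.1.1, hσ.2⟩, g, hg, hfg, fun n c => ?_⟩
  -- At the scale `max n c` the return time is at least `n`, hence of the form `n + k`, and the
  -- agreement reaches `c`.
  obtain ⟨j, hj, hXY⟩ := exists_return hF h hXT (max n c)
  obtain ⟨k, rfl⟩ := exists_add_of_le ((le_max_left n c).trans hj)
  obtain ⟨Y, hY, hseg, hlen⟩ := h.exists_image hF hX (n + k)
  refine ⟨k, Y, hY, ⟨fun l σ τ hσ hτ => ?_, fun m => ?_⟩,
    fun i hi => hXY Y hseg i (lt_max_of_lt_right hi)⟩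
  · have hσ := ((isRestriction_iff S).1 hσ).1
    rw [(hgit _ _ _ hσ.1).1 hτ]
    exact ⟨_, (isRestriction_iff S).2 ⟨hseg σ hσ, rfl⟩⟩
  · obtain ⟨σ, hσ, hl⟩ := hlen (m + 1)
    exact ⟨len σ, σ, it σ (n + k), _, (isRestriction_iff S).2 ⟨hσ, rfl⟩,
      (hgit _ _ _ hσ.1).2 rfl, (h.isString hF hσ.1 _).hasLength S, (add_one_le_iff' S _ _).1 hl⟩

end Recurrence

end SecondOrderArithmetic

theorem mainTheorem2 {M : Type*} [Zero M] [One M] [Add M] [Mul M] [LT M] (S : Set (Set M))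
    (hRCA : SecondOrderArithmetic.ModelsRCA0 S) (hWKL : SecondOrderArithmetic.WKL S) :
    SecondOrderArithmetic.RP S := by
  -- These structures extend the given operations and the given strict order, so the hypotheses and
  -- the goal keep their meaning.
  let := hRCA.commSemiring
  let := hRCA.linearOrder
  have := hRCA.isStrictOrderedRing
  have := hRCA.canonicallyOrderedAdd
  have : Fact (SecondOrderArithmetic.ModelsRCA0 S) := ⟨hRCA⟩
  exact SecondOrderArithmetic.WKL.recurrence S hWKL
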